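/- **Theorem (Grothendieck–Dolbeault lemma).** Let $E$ be a complex Banach space (for instance any finite-dimensional complex vector space), let $n\ge 0$, let $\mathcal O\subset\mathbb C^n$ be open, and let $\lambda$ be a $C^\infty$ differential form on $\mathcal O$ with values in $E$ which is pure of type $(r,s)$ with $r\ge 0$, $s\ge 1$. Here "pure of type $(r,s)$" means that $\lambda$ is a combination, with $C^\infty$ coefficients $\mathcal O\to E$, of exterior monomials of degree $r$ in $dz_1,\dots,dz_n$ and of degree $s$ in $d\bar z_1,\dots,d\bar z_n$; for such a form, $d\lambda=\partial\lambda+\bar\partial\lambda$ with $\partial\lambda$ pure of type $(r+1,s)$ and $\bar\partial\lambda=\sum_j d\bar z_j\wedge\partial\lambda/\partial\bar z_j$ pure of type $(r,s+1)$. The following conditions are equivalent: (i) $\bar\partial\lambda=0$ on $\mathcal O$; (ii) there are an open cover $(\mathcal O_\alpha)$ of $\mathcal O$ by subsets of $\mathcal O$ and, for every $\alpha$, a $C^\infty$ form $\mu_\alpha$ on $\mathcal O_\alpha$ with values in $E$, pure of type $(r,s-1)$, such that $\lambda|_{\mathcal O_\alpha}=\bar\partial\mu_\alpha$. -/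

import Mathlib

open scoped ContDiff

/-- The `2n` coordinate covectors on `ℂⁿ`: `Sum.inl i` stands for `dz_i`, the map `v ↦ v_i`, and
`Sum.inr j` stands for `dz̄_j`, the map `v ↦ conj v_j`. The space `ℂⁿ` is `Fin n → ℂ`; only its
vector space structure and its topology are used. -/
noncomputable def coordCovector {n : ℕ} : Fin n ⊕ Fin n → (Fin n → ℂ) →L[ℝ] ℂ
  | Sum.inl i => ContinuousLinearMap.proj i
  | Sum.inr j => Complex.conjCLE.toContinuousLinearMap.comp (ContinuousLinearMap.proj j)

/-- The exterior monomial `ζ_{K 0} ∧ ⋯ ∧ ζ_{K (p-1)}` in the coordinate covectors `ζ = dz_i, dz̄_j`: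
the complex-valued `p`-form `(v_0, …, v_{p-1}) ↦ det (ζ_{K a} (v_b))`. -/
noncomputable def wedgeMonomial {n p : ℕ} (K : Fin p → Fin n ⊕ Fin n) :
    (Fin n → ℂ) [⋀^Fin p]→L[ℝ] ℂ where
  toFun v := Matrix.det (Matrix.of fun a b => coordCovector (K a) (v b))
  map_update_add' {_} v i x y := by
    rename_i inst
    obtain rfl := Subsingleton.elim inst (instDecidableEqFin p)
    have key : ∀ z, (Matrix.of fun a b => coordCovector (K a) (Function.update v i z b)) =
        (Matrix.of fun a b => coordCovector (K a) (v b)).updateCol i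
          fun a => coordCovector (K a) z := by
      intro z
      ext a b
      by_cases h : b = i
      · subst h; simp
      · simp [h]
    rw [key, key, key, ← Matrix.det_updateCol_add]
    congr 2
    ext a
    simp
  map_update_smul' {_} v i c x := by
    rename_i inst
    obtain rfl := Subsingleton.elim inst (instDecidableEqFin p)
    have key : ∀ z, (Matrix.of fun a b => coordCovector (K a) (Function.update v i z b)) =
        (Matrix.of fun a b => coordCovector (K a) (v b)).updateCol i
          fun a => coordCovector (K a) z := by
      intro z
      ext a b
      by_cases h : b = i
      · subst h; simp
      · simp [h]
    rw [key, key, Complex.real_smul, ← Matrix.det_updateCol_smul]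
    congr 2
    ext a
    simp
  map_eq_zero_of_eq' v i j h hij := Matrix.det_zero_of_column_eq hij fun a => by simp [h]
  cont := by
    refine Continuous.matrix_det (A := fun v : Fin p → Fin n → ℂ =>
      Matrix.of fun a b => coordCovector (K a) (v b)) ?_
    refine continuous_matrix fun a b => ?_
    exact (coordCovector (K a)).continuous.comp (continuous_apply b)

theorem wedgeMonomial_apply {n p : ℕ} (K : Fin p → Fin n ⊕ Fin n) (v : Fin p → Fin n → ℂ) :
    wedgeMonomial K v = Matrix.det (Matrix.of fun a b => coordCovector (K a) (v b)) := rfl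

/-- The indices `K` of the monomials of degree `p` which have degree `r` in the `dz_i` and degree
`s` in the `dz̄_j`. -/
def bidegreeIndices (n p r s : ℕ) : Finset (Fin p → Fin n ⊕ Fin n) :=
  Finset.univ.filter fun K =>
    (Finset.univ.filter fun a => (K a).isLeft = true).card = r ∧
    (Finset.univ.filter fun a => (K a).isRight = true).card = s

/-- `η`, an `E`-valued differential form of degree `p`, is on `U` a `C^∞` form which is pure of type
`(r, s)`: it is a combination, with `C^∞` coefficients in `E`, of the monomials of degree `r` in the
`dz_i` and degree `s` in the `dz̄_j`. The values of `η` outside `U` play no role. -/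
def IsPureForm {n p : ℕ} {E : Type*} [NormedAddCommGroup E] [NormedSpace ℂ E] (r s : ℕ)
    (U : Set (Fin n → ℂ)) (η : (Fin n → ℂ) → (Fin n → ℂ) [⋀^Fin p]→L[ℝ] E) : Prop :=
  ∃ f : (Fin p → Fin n ⊕ Fin n) → (Fin n → ℂ) → E,
    (∀ K, ContDiffOn ℝ ∞ (f K) U) ∧
    ∀ x ∈ U, ∀ v, η x v = ∑ K ∈ bidegreeIndices n p r s, wedgeMonomial K v • f K x

/-- The complex-linear part `v ↦ (L v - i L (i v)) / 2` of a real-linear map `L`. -/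
noncomputable def linearPart {V F : Type*} [NormedAddCommGroup V] [NormedSpace ℂ V]
    [NormedAddCommGroup F] [NormedSpace ℂ F] (L : V →L[ℝ] F) : V →L[ℝ] F :=
  (1 / 2 : ℂ) • (L - Complex.I • L.comp (Complex.I • ContinuousLinearMap.id ℝ V))

/-- The complex-antilinear part `v ↦ (L v + i L (i v)) / 2` of a real-linear map `L`. -/
noncomputable def antilinearPart {V F : Type*} [NormedAddCommGroup V] [NormedSpace ℂ V]
    [NormedAddCommGroup F] [NormedSpace ℂ F] (L : V →L[ℝ] F) : V →L[ℝ] F :=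
  (1 / 2 : ℂ) • (L + Complex.I • L.comp (Complex.I • ContinuousLinearMap.id ℝ V))

/-- The operator `∂η = ∑ j, dz_j ∧ ∂η/∂z_j`: the same expression as the exterior derivative
`extDeriv η x = alternatizeUncurryFin (fderiv ℝ η x)`, with the complex-linear part of the
derivative. -/
noncomputable def del {n p : ℕ} {E : Type*} [NormedAddCommGroup E] [NormedSpace ℂ E]
    (η : (Fin n → ℂ) → (Fin n → ℂ) [⋀^Fin p]→L[ℝ] E) (x : Fin n → ℂ) :
    (Fin n → ℂ) [⋀^Fin (p + 1)]→L[ℝ] E :=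
  .alternatizeUncurryFin (linearPart (fderiv ℝ η x))

/-- The operator `∂̄η = ∑ j, dz̄_j ∧ ∂η/∂z̄_j`: the same expression as the exterior derivative
`extDeriv η x = alternatizeUncurryFin (fderiv ℝ η x)`, with the antilinear part of the derivative.
The facts `extDeriv_eq_del_add_delbar`, `IsPureForm.del` and `IsPureForm.delbar` below say that, on
forms pure of type `(r, s)`, `∂` and `∂̄` are the parts of `d` of types `(r + 1, s)` and
`(r, s + 1)`. -/
noncomputable def delbar {n p : ℕ} {E : Type*} [NormedAddCommGroup E] [NormedSpace ℂ E]
    (η : (Fin n → ℂ) → (Fin n → ℂ) [⋀^Fin p]→L[ℝ] E) (x : Fin n → ℂ) :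
    (Fin n → ℂ) [⋀^Fin (p + 1)]→L[ℝ] E :=
  .alternatizeUncurryFin (antilinearPart (fderiv ℝ η x))

theorem extDeriv_eq_del_add_delbar {n p : ℕ} {E : Type*} [NormedAddCommGroup E] [NormedSpace ℂ E]
    (η : (Fin n → ℂ) → (Fin n → ℂ) [⋀^Fin p]→L[ℝ] E) (x : Fin n → ℂ) :
    extDeriv η x = del η x + delbar η x := by
  rw [extDeriv, del, delbar, ← ContinuousAlternatingMap.alternatizeUncurryFin_add]
  congr 1
  ext1 w
  simp only [linearPart, antilinearPart, add_apply, smul_apply, sub_apply]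
  module

theorem wedgeMonomial_cons {n p : ℕ} (c : Fin n ⊕ Fin n) (K : Fin p → Fin n ⊕ Fin n)
    (v : Fin (p + 1) → Fin n → ℂ) :
    wedgeMonomial (Fin.cons c K : Fin (p + 1) → Fin n ⊕ Fin n) v =
      ∑ i : Fin (p + 1), (-1) ^ (i : ℕ) * coordCovector c (v i) * wedgeMonomial K (i.removeNth v) := by
  rw [wedgeMonomial_apply, Matrix.det_succ_row_zero]
  refine Finset.sum_congr rfl fun i _ => ?_
  rw [wedgeMonomial_apply]
  simp only [Matrix.of_apply, Fin.cons_zero]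
  rfl

/-- A form which is pure on `U` has a derivative on `U`, computed from that of its coefficients. -/
theorem fderiv_eq_of_pure {n p : ℕ} {E : Type*} [NormedAddCommGroup E] [NormedSpace ℂ E] {r s : ℕ}
    {U : Set (Fin n → ℂ)} (hU : IsOpen U) {η : (Fin n → ℂ) → (Fin n → ℂ) [⋀^Fin p]→L[ℝ] E}
    {f : (Fin p → Fin n ⊕ Fin n) → (Fin n → ℂ) → E} (hf : ∀ K, ContDiffOn ℝ ∞ (f K) U)
    (hη : ∀ x ∈ U, ∀ v, η x v = ∑ K ∈ bidegreeIndices n p r s, wedgeMonomial K v • f K x)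
    {x : Fin n → ℂ} (hx : x ∈ U) (w : Fin n → ℂ) (v : Fin p → Fin n → ℂ) :
    fderiv ℝ η x w v =
      ∑ K ∈ bidegreeIndices n p r s, wedgeMonomial K v • fderiv ℝ (f K) x w := by
  let A (K : Fin p → Fin n ⊕ Fin n) : E →L[ℝ] (Fin n → ℂ) [⋀^Fin p]→L[ℝ] E :=
    ((ContinuousLinearMap.compContinuousAlternatingMapCLM ℝ (Fin n → ℂ) ℂ E (Fin p)).flip
      (wedgeMonomial K)).comp (ContinuousLinearMap.lsmul ℝ ℂ : ℂ →L[ℝ] E →L[ℝ] E).flip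
  have hA : ∀ K e u, A K e u = wedgeMonomial K u • e := fun K e u => rfl
  have hev : η =ᶠ[nhds x] fun y => ∑ K ∈ bidegreeIndices n p r s, A K (f K y) := by
    filter_upwards [hU.mem_nhds hx] with y hy
    ext u
    simp [hη y hy u, hA, ContinuousAlternatingMap.sum_apply]
  have hd : HasFDerivAt (fun y => ∑ K ∈ bidegreeIndices n p r s, A K (f K y))
      (∑ K ∈ bidegreeIndices n p r s, (A K).comp (fderiv ℝ (f K) x)) x := by
    refine HasFDerivAt.fun_sum fun K _ => (A K).hasFDerivAt.comp x ?_
    exact (((hf K).contDiffAt (hU.mem_nhds hx)).differentiableAt (by simp)).hasFDerivAt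
  rw [hev.fderiv_eq, hd.fderiv]
  simp [hA, ContinuousAlternatingMap.sum_apply]

theorem linearPart_smul {V F : Type*} [NormedAddCommGroup V] [NormedSpace ℂ V]
    [NormedAddCommGroup F] [NormedSpace ℂ F] (L : V →L[ℝ] F) (c : ℂ) (w : V) :
    linearPart L (c • w) = c • linearPart L w := by
  have h : ∀ u : V, L (c • u) = c.re • L u + c.im • L (Complex.I • u) := by
    intro u
    rw [← map_smul, ← map_smul, ← map_add]
    congr 1
    conv_lhs => rw [← Complex.re_add_im c, add_smul, mul_smul]
    simp
  simp only [linearPart, smul_apply, sub_apply, ContinuousLinearMap.comp_apply,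
    ContinuousLinearMap.id_apply]
  rw [smul_comm Complex.I c w, h, h, smul_smul Complex.I Complex.I w, Complex.I_mul_I, neg_one_smul,
    map_neg]
  simp only [← Complex.coe_smul]
  conv_rhs => rw [← Complex.re_add_im c]
  match_scalars <;> (ring_nf; try simp [Complex.I_sq]; try ring)

theorem antilinearPart_smul {V F : Type*} [NormedAddCommGroup V] [NormedSpace ℂ V]
    [NormedAddCommGroup F] [NormedSpace ℂ F] (L : V →L[ℝ] F) (c : ℂ) (w : V) :
    antilinearPart L (c • w) = (starRingEnd ℂ) c • antilinearPart L w := by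
  have h : ∀ u : V, L (c • u) = c.re • L u + c.im • L (Complex.I • u) := by
    intro u
    rw [← map_smul, ← map_smul, ← map_add]
    congr 1
    conv_lhs => rw [← Complex.re_add_im c, add_smul, mul_smul]
    simp
  have hc : (starRingEnd ℂ) c = c.re - c.im * Complex.I := by
    apply Complex.ext <;> simp
  simp only [antilinearPart, smul_apply, add_apply, ContinuousLinearMap.comp_apply,
    ContinuousLinearMap.id_apply]
  rw [smul_comm Complex.I c w, h, h, smul_smul Complex.I Complex.I w, Complex.I_mul_I, neg_one_smul,
    map_neg, hc]
  simp only [← Complex.coe_smul]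
  match_scalars <;> (ring_nf; try simp [Complex.I_sq]; try ring)

theorem linearPart_apply_eq_sum {n : ℕ} {E : Type*} [NormedAddCommGroup E] [NormedSpace ℂ E]
    (L : (Fin n → ℂ) →L[ℝ] E) (w : Fin n → ℂ) :
    linearPart L w =
      ∑ j, coordCovector (Sum.inl j) w • linearPart L (Pi.single j (1 : ℂ)) := by
  conv_lhs => rw [pi_eq_sum_univ' w, map_sum]
  refine Finset.sum_congr rfl fun j _ => ?_
  rw [← linearPart_smul]
  congr 1

theorem antilinearPart_apply_eq_sum {n : ℕ} {E : Type*} [NormedAddCommGroup E] [NormedSpace ℂ E]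
    (L : (Fin n → ℂ) →L[ℝ] E) (w : Fin n → ℂ) :
    antilinearPart L w =
      ∑ j, coordCovector (Sum.inr j) w • antilinearPart L (Pi.single j (1 : ℂ)) := by
  conv_lhs => rw [pi_eq_sum_univ' w, map_sum]
  refine Finset.sum_congr rfl fun j _ => ?_
  have : coordCovector (Sum.inr j) w = (starRingEnd ℂ) (w j) := rfl
  rw [this, ← antilinearPart_smul]

theorem isPureForm_of_sum {n p : ℕ} {E : Type*} [NormedAddCommGroup E] [NormedSpace ℂ E]
    {r s r' s' : ℕ} {U : Set (Fin n → ℂ)}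
    {η : (Fin n → ℂ) → (Fin n → ℂ) [⋀^Fin (p + 1)]→L[ℝ] E} (c : Fin n → Fin n ⊕ Fin n)
    (hK : ∀ j, ∀ K : Fin p → Fin n ⊕ Fin n, K ∈ bidegreeIndices n p r s →
      (Fin.cons (c j) K : Fin (p + 1) → Fin n ⊕ Fin n) ∈ bidegreeIndices n (p + 1) r' s')
    (g : Fin n → (Fin p → Fin n ⊕ Fin n) → (Fin n → ℂ) → E)
    (hg : ∀ j K, ContDiffOn ℝ ∞ (g j K) U)
    (hη : ∀ x ∈ U, ∀ v, η x v = ∑ K ∈ bidegreeIndices n p r s, ∑ j,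
      wedgeMonomial (Fin.cons (c j) K : Fin (p + 1) → Fin n ⊕ Fin n) v • g j K x) :
    IsPureForm r' s' U η := by
  classical
  refine ⟨fun M x => ∑ K ∈ bidegreeIndices n p r s, ∑ j,
    if M = Fin.cons (c j) K then g j K x else 0, fun M => ?_, fun x hx v => ?_⟩
  · refine ContDiffOn.sum fun K _ => ContDiffOn.sum fun j _ => ?_
    split_ifs
    · exact hg j K
    · exact contDiffOn_const
  · rw [hη x hx v]
    simp_rw [Finset.smul_sum]
    symm
    rw [Finset.sum_comm]
    refine Finset.sum_congr rfl fun K hKm => ?_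
    rw [Finset.sum_comm]
    refine Finset.sum_congr rfl fun j _ => ?_
    simp [hK j K hKm]

theorem IsPureForm.del {n p : ℕ} {E : Type*} [NormedAddCommGroup E] [NormedSpace ℂ E] {r s : ℕ}
    {U : Set (Fin n → ℂ)} (hU : IsOpen U) {η : (Fin n → ℂ) → (Fin n → ℂ) [⋀^Fin p]→L[ℝ] E}
    (h : IsPureForm r s U η) : IsPureForm (r + 1) s U (_root_.del η) := by
  obtain ⟨f, hf, hη⟩ := h
  have hd : ∀ K, ContDiffOn ℝ ∞ (fun x => fderiv ℝ (f K) x) U := fun K =>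
    (hf K).fderiv_of_isOpen hU (by simp)
  refine isPureForm_of_sum (r := r) (s := s) Sum.inl (fun j K hK => ?_)
    (fun j K x => linearPart (fderiv ℝ (f K) x) (Pi.single j (1 : ℂ))) (fun j K => ?_)
    (fun x hx v => ?_)
  · simp only [bidegreeIndices, Finset.mem_filter, Finset.mem_univ, true_and,
      Fin.card_filter_univ_succ] at hK ⊢
    simp [hK.1, hK.2]
  · simp only [linearPart, smul_apply, sub_apply, ContinuousLinearMap.comp_apply]
    exact (((hd K).clm_apply contDiffOn_const).sub
      (((hd K).clm_apply contDiffOn_const).const_smul _)).const_smul _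
  · rw [_root_.del, ContinuousAlternatingMap.alternatizeUncurryFin_apply]
    have key : ∀ (w : Fin n → ℂ) (u : Fin p → Fin n → ℂ), linearPart (fderiv ℝ η x) w u =
        ∑ K ∈ bidegreeIndices n p r s, wedgeMonomial K u • linearPart (fderiv ℝ (f K) x) w := by
      intro w u
      simp only [linearPart, smul_apply, sub_apply, ContinuousLinearMap.comp_apply,
        ContinuousAlternatingMap.smul_apply, ContinuousAlternatingMap.sub_apply,
        fderiv_eq_of_pure hU hf hη hx, Finset.smul_sum, ← Finset.sum_sub_distrib]
      refine Finset.sum_congr rfl fun K _ => ?_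
      module
    simp only [key, wedgeMonomial_cons, Finset.smul_sum, Finset.sum_smul]
    rw [Finset.sum_comm]
    refine Finset.sum_congr rfl fun K _ => ?_
    rw [Finset.sum_comm]
    refine Finset.sum_congr rfl fun i _ => ?_
    rw [linearPart_apply_eq_sum, Finset.smul_sum, Finset.smul_sum]
    refine Finset.sum_congr rfl fun j _ => ?_
    rw [← Int.cast_smul_eq_zsmul ℂ, smul_smul, smul_smul]
    push_cast
    ring_nf

theorem IsPureForm.delbar {n p : ℕ} {E : Type*} [NormedAddCommGroup E] [NormedSpace ℂ E] {r s : ℕ}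
    {U : Set (Fin n → ℂ)} (hU : IsOpen U) {η : (Fin n → ℂ) → (Fin n → ℂ) [⋀^Fin p]→L[ℝ] E}
    (h : IsPureForm r s U η) : IsPureForm r (s + 1) U (_root_.delbar η) := by
  obtain ⟨f, hf, hη⟩ := h
  have hd : ∀ K, ContDiffOn ℝ ∞ (fun x => fderiv ℝ (f K) x) U := fun K =>
    (hf K).fderiv_of_isOpen hU (by simp)
  refine isPureForm_of_sum (r := r) (s := s) Sum.inr (fun j K hK => ?_)
    (fun j K x => antilinearPart (fderiv ℝ (f K) x) (Pi.single j (1 : ℂ))) (fun j K => ?_)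
    (fun x hx v => ?_)
  · simp only [bidegreeIndices, Finset.mem_filter, Finset.mem_univ, true_and,
      Fin.card_filter_univ_succ] at hK ⊢
    simp [hK.1, hK.2]
  · simp only [antilinearPart, smul_apply, add_apply, ContinuousLinearMap.comp_apply]
    exact (((hd K).clm_apply contDiffOn_const).add
      (((hd K).clm_apply contDiffOn_const).const_smul _)).const_smul _
  · rw [_root_.delbar, ContinuousAlternatingMap.alternatizeUncurryFin_apply]
    have key : ∀ (w : Fin n → ℂ) (u : Fin p → Fin n → ℂ), antilinearPart (fderiv ℝ η x) w u =
        ∑ K ∈ bidegreeIndices n p r s, wedgeMonomial K u • antilinearPart (fderiv ℝ (f K) x) w := by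
      intro w u
      simp only [antilinearPart, smul_apply, add_apply, ContinuousLinearMap.comp_apply,
        ContinuousAlternatingMap.smul_apply, ContinuousAlternatingMap.add_apply,
        fderiv_eq_of_pure hU hf hη hx, Finset.smul_sum, ← Finset.sum_add_distrib]
      refine Finset.sum_congr rfl fun K _ => ?_
      module
    simp only [key, wedgeMonomial_cons, Finset.smul_sum, Finset.sum_smul]
    rw [Finset.sum_comm]
    refine Finset.sum_congr rfl fun K _ => ?_
    rw [Finset.sum_comm]
    refine Finset.sum_congr rfl fun i _ => ?_
    rw [antilinearPart_apply_eq_sum, Finset.smul_sum, Finset.smul_sum]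
    refine Finset.sum_congr rfl fun j _ => ?_
    rw [← Int.cast_smul_eq_zsmul ℂ, smul_smul, smul_smul]
    push_cast
    ring_nf

/-! Write `ι_k` for contraction with `∂/∂z̄_k`. The converse direction is local and amounts to `∂̄∂̄
= 0`. For the direct one, a closed form of type `(r, s)`, `s ≥ 1`, is corrected by `∂̄`-exact forms
on shrinking polydiscs until every `ι_k` kills it. Euler's formula `∑ dz̄_j ∧ ι_j α = s α` then
forces it to vanish (`eq_zero_of_isAnn`).

One correction (`exists_delbar_isAnn_insert`) starts from a closed `η` with `ι_j η = 0` for `j ∈ S`.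
Let `ν` be the Cauchy transform in `z_k` of `g = χ ι_k η`, with `χ` a cutoff. By Cauchy–Pompeiu,
`∂ν/∂z̄_k = g`. Contractions anticommute, so `ι_k` and all `ι_j`, `j ∈ S`, kill `g`, hence also `ν`.
For an index `j` with `ι_j ν = 0`, Cartan's formula (`contr_delbar`) reduces to `ι_j ∂̄ν =
∂ν/∂z̄_j`. For `j = k` this is `g`, equal to `ι_k η` where `χ = 1`. For `j ∈ S`, `j ≠ k`, it is the
transform of `∂g/∂z̄_j`, which vanishes along the line of integration: `∂η/∂z̄_j = ι_j ∂̄η = 0` by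
Cartan again, and the product form of `χ` makes `∂χ/∂z̄_j` zero there. So `η - ∂̄ν` is killed by
`ι_k` as well as by the earlier contractions. -/

/-! ### Contractions with `∂/∂z̄_k`, Cartan's formula, and `∂̄∂̄ = 0`. -/

section Algebra

variable {n p : ℕ} {E : Type*} [NormedAddCommGroup E] [NormedSpace ℂ E]

/-- Contraction of a form with the vector field `∂/∂z̄_k`. -/
noncomputable def contr (k : Fin n) :
    ((Fin n → ℂ) [⋀^Fin (p + 1)]→L[ℝ] E) →L[ℝ] (Fin n → ℂ) [⋀^Fin p]→L[ℝ] E :=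
  (1 / 2 : ℂ) •
    ((ContinuousLinearMap.apply ℝ _ (Pi.single k (1 : ℂ) : Fin n → ℂ)).comp
        (ContinuousAlternatingMap.curryLeftLI
          (𝕜 := ℝ) (E := Fin n → ℂ) (F := E) (n := p)).toContinuousLinearMap +
      Complex.I • (ContinuousLinearMap.apply ℝ _
          (Complex.I • Pi.single k (1 : ℂ) : Fin n → ℂ)).comp
        (ContinuousAlternatingMap.curryLeftLI
          (𝕜 := ℝ) (E := Fin n → ℂ) (F := E) (n := p)).toContinuousLinearMap)

theorem contr_apply (k : Fin n) (α : (Fin n → ℂ) [⋀^Fin (p + 1)]→L[ℝ] E) (v : Fin p → Fin n → ℂ) :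
    contr k α v = (1 / 2 : ℂ) • (α (Fin.cons (Pi.single k (1 : ℂ)) v) +
      Complex.I • α (Fin.cons (Complex.I • Pi.single k (1 : ℂ)) v)) := rfl

theorem contr_smul (k : Fin n) (c : ℂ) (α : (Fin n → ℂ) [⋀^Fin (p + 1)]→L[ℝ] E) :
    contr k (c • α) = c • contr k α := by
  ext v
  simp only [contr_apply, ContinuousAlternatingMap.smul_apply]
  module

/-- The form `α` is annihilated by contraction with `∂/∂z̄_k`; in degree `0` this is no condition. -/
def IsAnn (k : Fin n) (α : (Fin n → ℂ) [⋀^Fin p]→L[ℝ] E) : Prop :=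
  ∀ (v : Fin p → Fin n → ℂ) (i : Fin p), (i : ℕ) = 0 →
    α (Function.update v i (Pi.single k (1 : ℂ))) +
      Complex.I • α (Function.update v i (Complex.I • Pi.single k (1 : ℂ))) = 0

theorem isAnn_iff_contr_eq_zero (k : Fin n) (α : (Fin n → ℂ) [⋀^Fin (p + 1)]→L[ℝ] E) :
    IsAnn k α ↔ contr k α = 0 := by
  constructor
  · intro h
    ext v
    have := h (Fin.cons 0 v) 0 rfl
    simp only [Fin.update_cons_zero] at this
    rw [contr_apply, this]
    simp
  · intro h v i hi
    obtain rfl : i = 0 := Fin.ext hi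
    have := contr_apply k α (Fin.tail v)
    rw [h] at this
    have h2 := (smul_eq_zero.1 this.symm).resolve_left (by norm_num)
    rw [← Fin.cons_self_tail v]
    simpa only [Fin.update_cons_zero] using h2

theorem IsAnn.contr_eq_zero {k : Fin n} {α : (Fin n → ℂ) [⋀^Fin (p + 1)]→L[ℝ] E}
    (h : IsAnn k α) : contr k α = 0 :=
  (isAnn_iff_contr_eq_zero k α).1 h

theorem IsAnn.smul {k : Fin n} {α : (Fin n → ℂ) [⋀^Fin p]→L[ℝ] E} (h : IsAnn k α) (c : ℂ) :
    IsAnn k (c • α) := by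
  intro v i hi
  simp only [ContinuousAlternatingMap.smul_apply]
  rw [smul_comm, ← smul_add, h v i hi, smul_zero]

theorem IsAnn.add {k : Fin n} {α θ : (Fin n → ℂ) [⋀^Fin p]→L[ℝ] E} (h : IsAnn k α)
    (h' : IsAnn k θ) : IsAnn k (α + θ) := by
  intro v i hi
  simp only [ContinuousAlternatingMap.add_apply]
  rw [smul_add, add_add_add_comm, h v i hi, h' v i hi, add_zero]

/-- The contractions with `∂/∂z̄_j` and `∂/∂z̄_k` anticommute. -/
theorem contr_contr (j k : Fin n) (α : (Fin n → ℂ) [⋀^Fin (p + 2)]→L[ℝ] E) :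
    contr j (contr k α) = - contr k (contr j α) := by
  have hs : ∀ (a b : Fin n → ℂ) (v : Fin p → Fin n → ℂ),
      α (Fin.cons a (Fin.cons b v : Fin (p + 1) → Fin n → ℂ)) =
        - α (Fin.cons b (Fin.cons a v : Fin (p + 1) → Fin n → ℂ)) := by
    intro a b v
    have := α.toAlternatingMap.map_swap (Fin.cons b (Fin.cons a v : Fin (p + 1) → Fin n → ℂ))
      (Fin.zero_ne_one : (0 : Fin (p + 2)) ≠ 1)
    refine Eq.trans ?_ this
    refine congrArg α (funext fun i => ?_)
    refine Fin.cases ?_ (fun i => Fin.cases ?_ (fun i => ?_) i) i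
    · simp
    · simp
    · rw [Function.comp_apply, Equiv.swap_apply_of_ne_of_ne (Fin.succ_ne_zero _) (by simp [Fin.ext_iff])]
      rfl
  ext v
  simp only [contr_apply, ContinuousAlternatingMap.neg_apply]
  rw [hs (Pi.single k 1), hs (Pi.single k 1), hs (Complex.I • Pi.single k 1),
    hs (Complex.I • Pi.single k 1)]
  module

/-- Anticommutation of `ι_k` with itself gives `2 ι_k ι_k = 0`. -/
theorem isAnn_contr_self (k : Fin n) (α : (Fin n → ℂ) [⋀^Fin (p + 1)]→L[ℝ] E) :
    IsAnn k (contr k α) := by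
  cases p with
  | zero => exact fun _ i => i.elim0
  | succ p =>
    rw [isAnn_iff_contr_eq_zero]
    have h : (2 : ℂ) • contr k (contr k α) = 0 := by
      rw [two_smul]
      nth_rewrite 1 [contr_contr]
      exact neg_add_cancel _
    exact (smul_eq_zero.1 h).resolve_left two_ne_zero

theorem IsAnn.contr {j : Fin n} {α : (Fin n → ℂ) [⋀^Fin (p + 1)]→L[ℝ] E} (h : IsAnn j α)
    (k : Fin n) : IsAnn j (contr k α) := by
  cases p with
  | zero => exact fun _ i => i.elim0
  | succ p => rw [isAnn_iff_contr_eq_zero, contr_contr, h.contr_eq_zero, map_zero, neg_zero]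

/-- Contraction of `∑ dz̄_j ∧ L (∂/∂z̄_j)` when `L` takes values in forms annihilated by `∂/∂z̄_k`. -/
theorem contr_alternatizeUncurryFin {k : Fin n}
    {L : (Fin n → ℂ) →L[ℝ] (Fin n → ℂ) [⋀^Fin p]→L[ℝ] E}
    (hL : ∀ w, L (Complex.I • w) = -Complex.I • L w) (h : ∀ w, IsAnn k (L w)) :
    contr k (.alternatizeUncurryFin L) = L (Pi.single k (1 : ℂ)) := by
  ext v
  simp only [contr_apply, ContinuousAlternatingMap.alternatizeUncurryFin_apply,
    Fin.sum_univ_succ, Fin.cons_zero, Fin.cons_succ]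
  -- In the later terms of the alternating sum the contracted vector fills the first slot of `L (v
  -- i)`, so they vanish. In the leading term, antilinearity of `L` makes the two halves equal,
  -- since `I * (-I) = 1`.
  have hz : ∀ i : Fin p, L (v i)
      (i.succ.removeNth (Fin.cons (Pi.single k (1 : ℂ)) v : Fin (p + 1) → Fin n → ℂ)) +
      Complex.I • L (v i) (i.succ.removeNth
        (Fin.cons (Complex.I • Pi.single k (1 : ℂ)) v : Fin (p + 1) → Fin n → ℂ)) = 0 := by
    intro i
    cases p with
    | zero => exact i.elim0
    | succ p =>
      have h2 : ∀ w : Fin n → ℂ, (i.succ.removeNth (Fin.cons w v : Fin (p + 2) → Fin n → ℂ)) =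
          Function.update (Fin.cons 0 (i.removeNth v) : Fin (p + 1) → Fin n → ℂ) 0 w := by
        intro w
        rw [Fin.update_cons_zero]
        ext a
        refine Fin.cases ?_ (fun a => ?_) a <;> simp [Fin.removeNth]
      rw [h2, h2]
      exact h _ _ 0 rfl
  have h0 : ∀ w : Fin n → ℂ, (0 : Fin (p + 1)).removeNth (Fin.cons w v : Fin (p + 1) → Fin n → ℂ) = v := by
    intro w
    ext a
    simp [Fin.removeNth]
  rw [h0, h0, hL, ContinuousAlternatingMap.smul_apply, smul_add Complex.I, add_add_add_comm, Finset.smul_sum,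
    ← Finset.sum_add_distrib, Finset.sum_eq_zero, add_zero]
  · simp only [Fin.val_zero, pow_zero, one_smul]
    rw [smul_smul]
    simp only [mul_neg, Complex.I_mul_I, neg_neg, one_smul]
    module
  · intro i _
    rw [smul_comm, ← smul_add, hz, smul_zero]

theorem antilinearPart_I_smul {V F : Type*} [NormedAddCommGroup V] [NormedSpace ℂ V]
    [NormedAddCommGroup F] [NormedSpace ℂ F] (L : V →L[ℝ] F) (w : V) :
    antilinearPart L (Complex.I • w) = -Complex.I • antilinearPart L w := by
  rw [antilinearPart_smul, Complex.conj_I]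

theorem antilinearPart_comp {V F G : Type*} [NormedAddCommGroup V] [NormedSpace ℂ V]
    [NormedAddCommGroup F] [NormedSpace ℂ F] [NormedAddCommGroup G] [NormedSpace ℂ G]
    {A : F →L[ℝ] G} (hA : ∀ (c : ℂ) x, A (c • x) = c • A x) (L : V →L[ℝ] F) :
    antilinearPart (A.comp L) = A.comp (antilinearPart L) := by
  ext w
  simp [antilinearPart, hA]

theorem antilinearPart_apply {V F : Type*} [NormedAddCommGroup V] [NormedSpace ℂ V]
    [NormedAddCommGroup F] [NormedSpace ℂ F] (L : V →L[ℝ] F) (w : V) :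
    antilinearPart L w = (1 / 2 : ℂ) • (L w + Complex.I • L (Complex.I • w)) := rfl

/-- Evaluation of forms at `v`, as a continuous linear map. -/
noncomputable def evalForm (v : Fin p → Fin n → ℂ) :
    ((Fin n → ℂ) [⋀^Fin p]→L[ℝ] E) →L[ℝ] E :=
  ContinuousAlternatingMap.apply ℝ (Fin n → ℂ) E v

theorem evalForm_apply (v : Fin p → Fin n → ℂ) (α : (Fin n → ℂ) [⋀^Fin p]→L[ℝ] E) :
    evalForm v α = α v := rfl

/-- `IsAnn k` is a set of continuous linear equations with constant coefficients, so it passes to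
derivatives. -/
theorem isAnn_fderiv {k : Fin n} {η : (Fin n → ℂ) → (Fin n → ℂ) [⋀^Fin p]→L[ℝ] E}
    {x : Fin n → ℂ} (hd : DifferentiableAt ℝ η x) (h : ∀ᶠ y in nhds x, IsAnn k (η y))
    (w : Fin n → ℂ) : IsAnn k (fderiv ℝ η x w) := by
  intro v i hi
  let A : ((Fin n → ℂ) [⋀^Fin p]→L[ℝ] E) →L[ℝ] E :=
    evalForm (Function.update v i (Pi.single k (1 : ℂ))) +
      Complex.I • evalForm (Function.update v i (Complex.I • Pi.single k (1 : ℂ)))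
  have h1 : (fun y => A (η y)) =ᶠ[nhds x] fun _ => 0 := h.mono fun y hy => hy v i hi
  have h2 : HasFDerivAt (fun y => A (η y)) (A.comp (fderiv ℝ η x)) x :=
    A.hasFDerivAt.comp x hd.hasFDerivAt
  have h3 : A.comp (fderiv ℝ η x) = 0 := by
    rw [← h2.fderiv, h1.fderiv_eq, fderiv_const_apply]
  exact congrArg (fun B => B w) h3

theorem IsAnn.antilinearPart {k : Fin n} {L : (Fin n → ℂ) →L[ℝ] (Fin n → ℂ) [⋀^Fin p]→L[ℝ] E}
    (h : ∀ w, IsAnn k (L w)) (w : Fin n → ℂ) : IsAnn k (antilinearPart L w) :=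
  ((h w).add ((h (Complex.I • w)).smul _)).smul _

/-- Cartan's formula for `∂̄` and the contraction with `∂/∂z̄_k`, on forms annihilated by `∂/∂z̄_k`. -/
theorem contr_delbar {k : Fin n} {η : (Fin n → ℂ) → (Fin n → ℂ) [⋀^Fin p]→L[ℝ] E}
    {x : Fin n → ℂ} (hd : DifferentiableAt ℝ η x) (h : ∀ᶠ y in nhds x, IsAnn k (η y)) :
    contr k (delbar η x) = antilinearPart (fderiv ℝ η x) (Pi.single k (1 : ℂ)) :=
  contr_alternatizeUncurryFin (antilinearPart_I_smul _)
    (IsAnn.antilinearPart (isAnn_fderiv hd h))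

/-- `antilinearPart` as a continuous linear map. -/
noncomputable def antilinearPartCLM (V F : Type*) [NormedAddCommGroup V] [NormedSpace ℂ V]
    [NormedAddCommGroup F] [NormedSpace ℂ F] : (V →L[ℝ] F) →L[ℝ] (V →L[ℝ] F) :=
  (1 / 2 : ℂ) • (ContinuousLinearMap.id ℝ _ + Complex.I •
    ContinuousLinearMap.precomp F (Complex.I • ContinuousLinearMap.id ℝ V))

theorem antilinearPartCLM_apply {V F : Type*} [NormedAddCommGroup V] [NormedSpace ℂ V]
    [NormedAddCommGroup F] [NormedSpace ℂ F] (L : V →L[ℝ] F) :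
    antilinearPartCLM V F L = antilinearPart L := rfl

/-- Taking antilinear parts in both slots of the symmetric second derivative leaves it symmetric,
and alternating a symmetric bilinear map gives zero. -/
theorem delbar_eq_zero_of_delbar {η : (Fin n → ℂ) → (Fin n → ℂ) [⋀^Fin p]→L[ℝ] E}
    {x : Fin n → ℂ} (h : ContDiffAt ℝ ∞ η x) : delbar (delbar η) x = 0 := by
  set D := fderiv ℝ (fderiv ℝ η) x with hD
  have hsymm : ∀ v w, D v w = D w v :=
    h.isSymmSndFDerivAt (by simp only [minSmoothness_of_isRCLikeNormedField]; exact WithTop.coe_le_coe.2 le_top)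
  have hd : HasFDerivAt (fderiv ℝ η) D x :=
    ((h.fderiv_right (m := 1) (WithTop.coe_le_coe.2 le_top)).differentiableAt (by simp)).hasFDerivAt
  have h1 : HasFDerivAt (delbar η)
      ((ContinuousAlternatingMap.alternatizeUncurryFinCLM ℝ (Fin n → ℂ) E).comp
        ((antilinearPartCLM _ _).comp D)) x :=
    (ContinuousAlternatingMap.alternatizeUncurryFinCLM ℝ (Fin n → ℂ) E).hasFDerivAt.comp x
      ((antilinearPartCLM _ ((Fin n → ℂ) [⋀^Fin p]→L[ℝ] E)).hasFDerivAt.comp x hd)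
  have h2 := antilinearPart_comp (V := Fin n → ℂ)
    (F := (Fin n → ℂ) →L[ℝ] (Fin n → ℂ) [⋀^Fin p]→L[ℝ] E)
    (G := (Fin n → ℂ) [⋀^Fin (p + 1)]→L[ℝ] E)
    (A := ContinuousAlternatingMap.alternatizeUncurryFinCLM (n := p) ℝ (Fin n → ℂ) E)
    (fun c L => ContinuousAlternatingMap.alternatizeUncurryFin_smul c L)
    ((antilinearPartCLM _ _).comp D)
  rw [delbar, h1.fderiv, h2]
  apply ContinuousAlternatingMap.alternatizeUncurryFin_alternatizeUncurryFinCLM_comp_of_symmetric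
  intro v w
  simp only [antilinearPart_apply, ContinuousLinearMap.comp_apply, antilinearPartCLM_apply,
    smul_apply, add_apply]
  rw [hsymm w v, hsymm (Complex.I • w) v, hsymm w (Complex.I • v),
    hsymm (Complex.I • w) (Complex.I • v)]
  module

end Algebra

/-! ### Contractions of monomials, Euler's formula, and stability of pure forms. -/

section PureForms

variable {n p : ℕ} {E : Type*} [NormedAddCommGroup E] [NormedSpace ℂ E]

theorem coordCovector_inl (i : Fin n) (w : Fin n → ℂ) : coordCovector (Sum.inl i) w = w i := rfl

theorem coordCovector_inr (i : Fin n) (w : Fin n → ℂ) :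
    coordCovector (Sum.inr i) w = (starRingEnd ℂ) (w i) := rfl

theorem wedgeMonomial_cons_apply (K : Fin (p + 1) → Fin n ⊕ Fin n) (w : Fin n → ℂ)
    (v : Fin p → Fin n → ℂ) :
    wedgeMonomial K (Fin.cons w v) =
      ∑ a : Fin (p + 1), (-1) ^ (a : ℕ) * coordCovector (K a) w * wedgeMonomial (K ∘ a.succAbove) v := by
  rw [wedgeMonomial_apply, Matrix.det_succ_column_zero]
  rfl

/-- The field `∂/∂z̄_k` is `(e_k + i·(i e_k)) / 2`: complex-linear covectors cancel through `1 + i²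
= 0`, while antilinear ones give `1 - i² = 2`. -/
theorem contr_coordCovector (k : Fin n) (c : Fin n ⊕ Fin n) :
    (1 / 2 : ℂ) * (coordCovector c (Pi.single k (1 : ℂ)) +
      Complex.I * coordCovector c (Complex.I • Pi.single k (1 : ℂ))) =
    if c = Sum.inr k then 1 else 0 := by
  rcases c with i | i
  · simp only [coordCovector_inl, Pi.smul_apply, smul_eq_mul, reduceCtorEq, if_false]
    rw [← mul_assoc, Complex.I_mul_I]
    ring
  · simp only [coordCovector_inr, Pi.smul_apply, smul_eq_mul, Sum.inr.injEq, map_mul,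
      Complex.conj_I]
    rw [← mul_assoc, mul_neg, Complex.I_mul_I]
    by_cases h : i = k
    · subst h
      simp
      norm_num
    · simp [h]

/-- Laplace expansion along the first column: only the rows equal to `dz̄_k` pair nontrivially with
`∂/∂z̄_k`. -/
theorem contr_wedgeMonomial_apply (k : Fin n) (K : Fin (p + 1) → Fin n ⊕ Fin n)
    (v : Fin p → Fin n → ℂ) :
    contr k (wedgeMonomial K) v =
      ∑ a : Fin (p + 1), if K a = Sum.inr k then (-1) ^ (a : ℕ) * wedgeMonomial (K ∘ a.succAbove) v else 0 := by
  rw [contr_apply, wedgeMonomial_cons_apply, wedgeMonomial_cons_apply]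
  rw [Finset.smul_sum, ← Finset.sum_add_distrib, Finset.smul_sum]
  refine Finset.sum_congr rfl fun a _ => ?_
  simp only [smul_eq_mul]
  have h := contr_coordCovector k (K a)
  calc _ = (-1) ^ (a : ℕ) * wedgeMonomial (K ∘ a.succAbove) v *
      ((1 / 2 : ℂ) * (coordCovector (K a) (Pi.single k (1 : ℂ)) +
      Complex.I * coordCovector (K a) (Complex.I • Pi.single k (1 : ℂ)))) := by ring
    _ = _ := by
      rw [h]
      split_ifs <;> simp

theorem contr_apply_of_eq_sum {ι : Type*} (s : Finset ι) (K : ι → Fin (p + 1) → Fin n ⊕ Fin n)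
    (f : ι → E) {α : (Fin n → ℂ) [⋀^Fin (p + 1)]→L[ℝ] E}
    (h : ∀ v, α v = ∑ i ∈ s, wedgeMonomial (K i) v • f i) (k : Fin n) (v : Fin p → Fin n → ℂ) :
    contr k α v = ∑ i ∈ s, contr k (wedgeMonomial (K i)) v • f i := by
  simp only [contr_apply, h, Finset.smul_sum, ← Finset.sum_add_distrib]
  refine Finset.sum_congr rfl fun i _ => ?_
  simp only [smul_eq_mul]
  module

/-- Euler's formula `∑ j, dz̄_j ∧ ι_j α = s α` on monomials of degree `s` in the `dz̄_j`. -/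
theorem sum_contr_wedgeMonomial {r s : ℕ} {K : Fin (p + 1) → Fin n ⊕ Fin n}
    (hK : K ∈ bidegreeIndices n (p + 1) r s) (v : Fin (p + 1) → Fin n → ℂ) :
    ∑ i : Fin (p + 1), ∑ j, (-1) ^ (i : ℕ) * coordCovector (Sum.inr j) (v i) *
      contr j (wedgeMonomial K) (i.removeNth v) = s * wedgeMonomial K v := by
  have hs : (Finset.univ.filter fun a => (K a).isRight = true).card = s :=
    (Finset.mem_filter.1 hK).2.2
  simp only [contr_wedgeMonomial_apply, Finset.mul_sum]
  -- If row `a` is some `dz̄_b`, the sum over `i` is the Laplace expansion of the determinant along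
  -- that row. There are `s` such rows, whence the factor `s`.
  have h1 : ∀ a : Fin (p + 1), ∑ i : Fin (p + 1), ∑ j,
      (-1) ^ (i : ℕ) * coordCovector (Sum.inr j) (v i) * (if K a = Sum.inr j then
        (-1) ^ (a : ℕ) * wedgeMonomial (K ∘ a.succAbove) (i.removeNth v) else 0) =
      if (K a).isRight = true then wedgeMonomial K v else 0 := by
    intro a
    rcases hKa : K a with b | b
    · simp
    · simp only [Sum.inr.injEq, mul_ite, mul_zero, Finset.sum_ite_eq, Finset.mem_univ, if_true,
        Sum.isRight_inr]
      rw [wedgeMonomial_apply, Matrix.det_succ_row _ a]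
      refine Finset.sum_congr rfl fun i _ => ?_
      simp only [Matrix.of_apply, hKa, pow_add, wedgeMonomial_apply]
      rw [show (Matrix.of fun c d => coordCovector ((K ∘ a.succAbove) c) (i.removeNth v d)) =
        (Matrix.of fun c d => coordCovector (K c) (v d)).submatrix a.succAbove i.succAbove from rfl]
      ring
  calc _ = ∑ a : Fin (p + 1), ∑ i : Fin (p + 1), ∑ j,
      (-1) ^ (i : ℕ) * coordCovector (Sum.inr j) (v i) * (if K a = Sum.inr j then
        (-1) ^ (a : ℕ) * wedgeMonomial (K ∘ a.succAbove) (i.removeNth v) else 0) := by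
        symm
        rw [Finset.sum_comm]
        refine Finset.sum_congr rfl fun i _ => ?_
        rw [Finset.sum_comm]
    _ = _ := by
      simp only [h1]
      rw [← Finset.sum_filter, Finset.sum_const, hs, nsmul_eq_mul]

/-- A form of type `(r, s)`, `s ≠ 0`, annihilated by all `∂/∂z̄_j` vanishes. -/
theorem eq_zero_of_isAnn {r s : ℕ} (hs : s ≠ 0) (f : (Fin (p + 1) → Fin n ⊕ Fin n) → E)
    {α : (Fin n → ℂ) [⋀^Fin (p + 1)]→L[ℝ] E}
    (h : ∀ v, α v = ∑ K ∈ bidegreeIndices n (p + 1) r s, wedgeMonomial K v • f K)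
    (h0 : ∀ j, IsAnn j α) : α = 0 := by
  ext v
  -- Euler's formula extends from monomials to `α` because the factor `s` is the same for all of
  -- them.
  have h1 : (s : ℂ) • α v = ∑ i : Fin (p + 1), ∑ j, ((-1) ^ (i : ℕ) *
      coordCovector (Sum.inr j) (v i)) • contr j α (i.removeNth v) := by
    simp only [contr_apply_of_eq_sum _ (fun K => K) f h, Finset.smul_sum, smul_smul]
    rw [h, Finset.smul_sum]
    simp only [Finset.sum_comm (s := (Finset.univ : Finset (Fin n)))
      (t := bidegreeIndices n (p + 1) r s)]
    rw [Finset.sum_comm]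
    refine Finset.sum_congr rfl fun K hK => ?_
    rw [smul_smul, ← sum_contr_wedgeMonomial hK, Finset.sum_smul]
    simp only [Finset.sum_smul]
  simp only [(h0 _).contr_eq_zero] at h1
  have h2 : (s : ℂ) • α v = 0 := by
    rw [h1]
    exact Finset.sum_eq_zero fun i _ => Finset.sum_eq_zero fun j _ => smul_zero _
  exact (smul_eq_zero.1 h2).resolve_left (by exact_mod_cast hs)

theorem comp_succAbove_mem_bidegreeIndices {r s : ℕ} {K : Fin (p + 1) → Fin n ⊕ Fin n}
    (hK : K ∈ bidegreeIndices n (p + 1) r s) {a : Fin (p + 1)} {k : Fin n} (ha : K a = Sum.inr k) :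
    K ∘ a.succAbove ∈ bidegreeIndices n p r (s - 1) := by
  simp only [bidegreeIndices, Finset.mem_filter, Finset.mem_univ, true_and, Finset.card_filter,
    Fin.sum_univ_succAbove _ a, ha, Sum.isLeft_inr, Sum.isRight_inr] at hK ⊢
  refine ⟨?_, ?_⟩
  · simpa using hK.1
  · have := hK.2
    simp only [if_true] at this
    simp only [Function.comp_apply]
    -- Row `a` itself contributes `1` to the count, so the truncated subtraction `s - 1` is exact.
    omega

/-- The contraction of a combination of monomials is pure. -/
theorem isPureForm_of_contr {r s : ℕ} {U : Set (Fin n → ℂ)}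
    {μ : (Fin n → ℂ) → (Fin n → ℂ) [⋀^Fin p]→L[ℝ] E} (k : Fin n)
    (g : (Fin (p + 1) → Fin n ⊕ Fin n) → (Fin n → ℂ) → E) (hg : ∀ K, ContDiffOn ℝ ∞ (g K) U)
    (hμ : ∀ x ∈ U, ∀ v, μ x v =
      ∑ K ∈ bidegreeIndices n (p + 1) r s, contr k (wedgeMonomial K) v • g K x) :
    IsPureForm r (s - 1) U μ := by
  classical
  -- The coefficient of `M` gathers, with sign, all ways to obtain `M` by deleting a factor `dz̄_k`
  -- from some `K`.
  refine ⟨fun M x => ∑ K ∈ bidegreeIndices n (p + 1) r s, ∑ a : Fin (p + 1),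
    if K a = Sum.inr k ∧ M = K ∘ a.succAbove then (-1 : ℂ) ^ (a : ℕ) • g K x else 0,
    fun M => ?_, fun x hx v => ?_⟩
  · refine ContDiffOn.sum fun K _ => ContDiffOn.sum fun a _ => ?_
    split_ifs
    · exact (hg K).const_smul _
    · exact contDiffOn_const
  · rw [hμ x hx v]
    simp_rw [Finset.smul_sum]
    symm
    rw [Finset.sum_comm]
    refine Finset.sum_congr rfl fun K hK => ?_
    rw [Finset.sum_comm, contr_wedgeMonomial_apply, Finset.sum_smul]
    refine Finset.sum_congr rfl fun a _ => ?_
    by_cases ha : K a = Sum.inr k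
    · simp only [ha, true_and, if_true, smul_ite, smul_zero, Finset.sum_ite_eq',
        comp_succAbove_mem_bidegreeIndices hK ha]
      rw [smul_smul, mul_comm]
    · simp [ha]

theorem IsPureForm.mono {r s : ℕ} {U V : Set (Fin n → ℂ)}
    {η : (Fin n → ℂ) → (Fin n → ℂ) [⋀^Fin p]→L[ℝ] E} (h : IsPureForm r s U η) (hV : V ⊆ U) :
    IsPureForm r s V η := by
  obtain ⟨f, hf, hη⟩ := h
  exact ⟨f, fun K => (hf K).mono hV, fun x hx => hη x (hV hx)⟩

theorem IsPureForm.zero {r s : ℕ} {U : Set (Fin n → ℂ)} :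
    IsPureForm r s U (fun _ => (0 : (Fin n → ℂ) [⋀^Fin p]→L[ℝ] E)) :=
  ⟨fun _ _ => 0, fun _ => contDiffOn_const, fun x _ v => by simp⟩

theorem IsPureForm.add {r s : ℕ} {U : Set (Fin n → ℂ)}
    {η θ : (Fin n → ℂ) → (Fin n → ℂ) [⋀^Fin p]→L[ℝ] E} (h : IsPureForm r s U η)
    (h' : IsPureForm r s U θ) : IsPureForm r s U (fun x => η x + θ x) := by
  obtain ⟨f, hf, hη⟩ := h
  obtain ⟨g, hg, hθ⟩ := h'
  refine ⟨fun K x => f K x + g K x, fun K => (hf K).add (hg K), fun x hx v => ?_⟩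
  simp only [ContinuousAlternatingMap.add_apply, hη x hx, hθ x hx, smul_add,
    Finset.sum_add_distrib]

theorem IsPureForm.sub {r s : ℕ} {U : Set (Fin n → ℂ)}
    {η θ : (Fin n → ℂ) → (Fin n → ℂ) [⋀^Fin p]→L[ℝ] E} (h : IsPureForm r s U η)
    (h' : IsPureForm r s U θ) : IsPureForm r s U (fun x => η x - θ x) := by
  obtain ⟨f, hf, hη⟩ := h
  obtain ⟨g, hg, hθ⟩ := h'
  refine ⟨fun K x => f K x - g K x, fun K => (hf K).sub (hg K), fun x hx v => ?_⟩
  simp only [ContinuousAlternatingMap.sub_apply, hη x hx, hθ x hx, smul_sub,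
    Finset.sum_sub_distrib]

theorem IsPureForm.contDiffOn {r s : ℕ} {U : Set (Fin n → ℂ)}
    {η : (Fin n → ℂ) → (Fin n → ℂ) [⋀^Fin p]→L[ℝ] E} (h : IsPureForm r s U η) :
    ContDiffOn ℝ ∞ η U := by
  obtain ⟨f, hf, hη⟩ := h
  let A (K : Fin p → Fin n ⊕ Fin n) : E →L[ℝ] (Fin n → ℂ) [⋀^Fin p]→L[ℝ] E :=
    ((ContinuousLinearMap.compContinuousAlternatingMapCLM ℝ (Fin n → ℂ) ℂ E (Fin p)).flip
      (wedgeMonomial K)).comp (ContinuousLinearMap.lsmul ℝ ℂ : ℂ →L[ℝ] E →L[ℝ] E).flip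
  have hA : ∀ K e u, A K e u = wedgeMonomial K u • e := fun K e u => rfl
  have h1 : ContDiffOn ℝ ∞ (fun y => ∑ K ∈ bidegreeIndices n p r s, A K (f K y)) U :=
    ContDiffOn.sum fun K _ => (A K).contDiff.comp_contDiffOn (hf K)
  refine h1.congr fun x hx => ?_
  ext u
  simp [hη x hx u, hA, ContinuousAlternatingMap.sum_apply]

theorem delbar_add {η θ : (Fin n → ℂ) → (Fin n → ℂ) [⋀^Fin p]→L[ℝ] E} {x : Fin n → ℂ}
    (h : DifferentiableAt ℝ η x) (h' : DifferentiableAt ℝ θ x) :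
    delbar (fun y => η y + θ y) x = delbar η x + delbar θ x := by
  rw [delbar, fderiv_fun_add h h', ← antilinearPartCLM_apply, map_add,
    ContinuousAlternatingMap.alternatizeUncurryFin_add]
  rfl

theorem delbar_sub {η θ : (Fin n → ℂ) → (Fin n → ℂ) [⋀^Fin p]→L[ℝ] E} {x : Fin n → ℂ}
    (h : DifferentiableAt ℝ η x) (h' : DifferentiableAt ℝ θ x) :
    delbar (fun y => η y - θ y) x = delbar η x - delbar θ x := by
  rw [delbar, fderiv_fun_sub h h', ← antilinearPartCLM_apply, map_sub,
    ← ContinuousAlternatingMap.alternatizeUncurryFinCLM_apply, map_sub]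
  rfl

theorem delbar_congr {η θ : (Fin n → ℂ) → (Fin n → ℂ) [⋀^Fin p]→L[ℝ] E} {x : Fin n → ℂ}
    (h : η =ᶠ[nhds x] θ) : delbar η x = delbar θ x := by
  rw [delbar, delbar, h.fderiv_eq]

end PureForms

/-! ### The Cauchy–Pompeiu formula and the Cauchy transform in one variable. -/

section CauchyTransform

open MeasureTheory Set

theorem hasDerivAt_mul_exp_mul_I (r θ : ℝ) :
    HasDerivAt (fun t : ℝ => (r : ℂ) * Complex.exp (t * Complex.I))
      (r * (Complex.I * Complex.exp (θ * Complex.I))) θ := by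
  have h1 : HasDerivAt (fun t : ℝ => (t : ℂ) * Complex.I) Complex.I θ := by
    simpa using (Complex.ofRealCLM.hasDerivAt (x := θ)).mul_const Complex.I
  simpa [mul_comm] using h1.cexp.const_mul (r : ℂ)

variable {F : Type*} [NormedAddCommGroup F] [NormedSpace ℂ F]

/-- The Jacobian `r` cancels the modulus of `1 / z`. The remaining `e^{-iθ}` is the conjugate of
`e^{iθ}` and moves inside the antilinear part, leaving a radial and an angular derivative. -/
theorem inv_smul_antilinearPart_polar (L : ℂ →L[ℝ] F) {r : ℝ} (hr : 0 < r) (θ : ℝ) :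
    r • ((r * Complex.exp (θ * Complex.I))⁻¹ • antilinearPart L 1) =
      (1 / 2 : ℂ) • (L (Complex.exp (θ * Complex.I)) +
        Complex.I • L (Complex.I * Complex.exp (θ * Complex.I))) := by
  have h1 := antilinearPart_smul L (Complex.exp (θ * Complex.I)) 1
  have h2 : (Complex.exp (θ * Complex.I))⁻¹ = (starRingEnd ℂ) (Complex.exp (θ * Complex.I)) := by
    refine inv_eq_of_mul_eq_one_right ?_
    rw [Complex.mul_conj, Complex.normSq_eq_norm_sq, Complex.norm_exp_ofReal_mul_I]
    simp
  rw [smul_eq_mul, mul_one, antilinearPart_apply, smul_eq_mul] at h1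
  rw [h1, ← Complex.coe_smul, smul_smul, mul_inv, h2, ← mul_assoc,
    mul_inv_cancel₀ (by exact_mod_cast hr.ne'), one_mul]

/-- Fundamental theorem of calculus along a ray, whose far end lies where `h` vanishes. -/
theorem integral_fderiv_radial [CompleteSpace F] {h : ℂ → F} (hh : ContDiff ℝ 1 h) {R : ℝ} (hR : 0 < R)
    (h0 : ∀ z, R ≤ ‖z‖ → h z = 0) (θ : ℝ) :
    ∫ r in Ioc 0 R, fderiv ℝ h (r * Complex.exp (θ * Complex.I)) (Complex.exp (θ * Complex.I)) =
      - h 0 := by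
  rw [← intervalIntegral.integral_of_le hR.le]
  have hd : ∀ r : ℝ, HasDerivAt (fun r : ℝ => h (r * Complex.exp (θ * Complex.I)))
      (fderiv ℝ h (r * Complex.exp (θ * Complex.I)) (Complex.exp (θ * Complex.I))) r := by
    intro r
    have h1 : HasDerivAt (fun t : ℝ => (t : ℂ) * Complex.exp (θ * Complex.I))
        (Complex.exp (θ * Complex.I)) r := by
      simpa using (Complex.ofRealCLM.hasDerivAt (x := r)).mul_const (Complex.exp (θ * Complex.I))
    exact ((hh.differentiable one_ne_zero _).hasFDerivAt).comp_hasDerivAt r h1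
  rw [intervalIntegral.integral_eq_sub_of_hasDerivAt fun r _ => hd r]
  · rw [h0]
    · simp
    · simp [Complex.norm_exp_ofReal_mul_I, le_abs_self]
  · apply Continuous.intervalIntegrable
    exact ((hh.continuous_fderiv one_ne_zero).comp (by fun_prop)).clm_apply continuous_const

/-- The integrand is the derivative of the `2π`-periodic function `θ ↦ r⁻¹ h(r e^{iθ})`. -/
theorem integral_fderiv_angular [CompleteSpace F] {h : ℂ → F} (hh : ContDiff ℝ 1 h) {r : ℝ} (hr : 0 < r) :
    ∫ θ in Ioo (-Real.pi) Real.pi, fderiv ℝ h (r * Complex.exp (θ * Complex.I))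
      (Complex.I * Complex.exp (θ * Complex.I)) = 0 := by
  rw [← integral_Ioc_eq_integral_Ioo,
    ← intervalIntegral.integral_of_le (by linarith [Real.pi_pos])]
  have hd : ∀ θ : ℝ, HasDerivAt (fun θ : ℝ => r⁻¹ • h (r * Complex.exp (θ * Complex.I)))
      (fderiv ℝ h (r * Complex.exp (θ * Complex.I)) (Complex.I * Complex.exp (θ * Complex.I))) θ := by
    intro θ
    have h2 := (((hh.differentiable one_ne_zero _).hasFDerivAt).comp_hasDerivAt θ
      (hasDerivAt_mul_exp_mul_I r θ)).const_smul r⁻¹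
    rw [← map_smul] at h2
    convert h2 using 1
    congr 1
    rw [Complex.real_smul, ← mul_assoc, ← Complex.ofReal_mul, inv_mul_cancel₀ hr.ne',
      Complex.ofReal_one, one_mul]
  rw [intervalIntegral.integral_eq_sub_of_hasDerivAt fun r _ => hd r]
  · simp [Complex.exp_neg, Complex.exp_pi_mul_I]
  · apply Continuous.intervalIntegrable
    exact ((hh.continuous_fderiv one_ne_zero).comp (by fun_prop)).clm_apply (by fun_prop)

/-- The Cauchy–Pompeiu formula for a compactly supported function, at the origin. -/
theorem integral_inv_smul_antilinearPart [CompleteSpace F] {h : ℂ → F} (hh : ContDiff ℝ 1 h) {R : ℝ} (hR : 0 < R)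
    (h0 : ∀ z, R ≤ ‖z‖ → h z = 0) :
    ∫ z, z⁻¹ • antilinearPart (fderiv ℝ h z) (1 : ℂ) = (-Real.pi : ℂ) • h 0 := by
  have hf0 : ∀ z, R < ‖z‖ → fderiv ℝ h z = 0 := by
    intro z hz
    have : h =ᶠ[nhds z] fun _ => 0 := by
      filter_upwards [continuous_norm.continuousAt.eventually (lt_mem_nhds hz)] with y hy
      exact h0 y hy.le
    rw [this.fderiv_eq]
    simp
  let A : ℝ × ℝ → F := fun q =>
    fderiv ℝ h (q.1 * Complex.exp (q.2 * Complex.I)) (Complex.exp (q.2 * Complex.I))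
  let B : ℝ × ℝ → F := fun q =>
    fderiv ℝ h (q.1 * Complex.exp (q.2 * Complex.I)) (Complex.I * Complex.exp (q.2 * Complex.I))
  have hA : Continuous A :=
    ((hh.continuous_fderiv one_ne_zero).comp (by fun_prop)).clm_apply (by fun_prop)
  have hB : Continuous B :=
    ((hh.continuous_fderiv one_ne_zero).comp (by fun_prop)).clm_apply (by fun_prop)
  have hint : ∀ G : ℝ × ℝ → F, Continuous G →
      IntegrableOn G (Ioc 0 R ×ˢ Ioo (-Real.pi) Real.pi) := fun G hG =>
    (hG.continuousOn.integrableOn_compact (isCompact_Icc.prod isCompact_Icc)).mono_set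
      (prod_mono Ioc_subset_Icc_self Ioo_subset_Icc_self)
  rw [← Complex.integral_comp_polarCoord_symm]
  have h1 : ∀ q ∈ polarCoord.target, q.1 • ((Complex.polarCoord.symm q)⁻¹ •
      antilinearPart (fderiv ℝ h (Complex.polarCoord.symm q)) (1 : ℂ)) =
      (1 / 2 : ℂ) • (A q + Complex.I • B q) := by
    intro q hq
    have hq1 : 0 < q.1 := hq.1
    rw [Complex.polarCoord_symm_apply]
    simp only [Complex.ofReal_cos, Complex.ofReal_sin, ← Complex.exp_mul_I]
    exact inv_smul_antilinearPart_polar _ hq1 _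
  rw [setIntegral_congr_fun polarCoord.open_target.measurableSet h1, integral_smul]
  -- The derivative vanishes for radius beyond `R`; on the bounded rectangle that remains,
  -- continuity gives the integrability needed for Fubini.
  have h2 : ∫ q in polarCoord.target, (A q + Complex.I • B q) =
      ∫ q in Ioc 0 R ×ˢ Ioo (-Real.pi) Real.pi, (A q + Complex.I • B q) := by
    refine setIntegral_eq_of_subset_of_forall_sdiff_eq_zero polarCoord.open_target.measurableSet
      (prod_mono Ioc_subset_Ioi_self subset_rfl) ?_
    rintro q ⟨hq, hq'⟩
    have hq1 : 0 < q.1 := hq.1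
    have hqR : R < q.1 := by
      by_contra hle
      exact hq' ⟨⟨hq1, not_lt.1 hle⟩, hq.2⟩
    have : fderiv ℝ h (q.1 * Complex.exp (q.2 * Complex.I)) = 0 := by
      apply hf0
      simpa [Complex.norm_exp_ofReal_mul_I, abs_of_pos hq1] using hqR
    simp [A, B, this]
  -- The radial variable is integrated first: each angle gives `-h 0`, and the angles have total
  -- length `2π`. The factor `1 / 2` then yields `-π`.
  have h3 : ∫ q in Ioc 0 R ×ˢ Ioo (-Real.pi) Real.pi, A q = (-(2 * Real.pi) : ℂ) • h 0 := by
    rw [Measure.volume_eq_prod, ← setIntegral_prod_swap, setIntegral_prod]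
    · have : ∀ θ : ℝ, ∫ r in Ioc 0 R, A (Prod.swap (θ, r)) = - h 0 := fun θ =>
        integral_fderiv_radial hh hR h0 θ
      simp only [this]
      rw [setIntegral_const, Real.volume_real_Ioo_of_le (by linarith [Real.pi_pos]),
        ← Complex.coe_smul]
      push_cast
      module
    · rw [← Measure.volume_eq_prod]
      exact ((hA.comp continuous_swap).continuousOn.integrableOn_compact
        (isCompact_Icc.prod isCompact_Icc)).mono_set
        (prod_mono Ioo_subset_Icc_self Ioc_subset_Icc_self)
  have h4 : ∫ q in Ioc 0 R ×ˢ Ioo (-Real.pi) Real.pi, B q = 0 := by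
    rw [Measure.volume_eq_prod, setIntegral_prod]
    · exact setIntegral_eq_zero_of_forall_eq_zero fun r hr => integral_fderiv_angular hh hr.1
    · exact hint B hB
  rw [h2, integral_add (hint A hA) (hint (fun q => Complex.I • B q) (hB.const_smul _)),
    integral_smul, h3, h4]
  module

variable {n : ℕ}

/-- The singularity has order `1`, less than the real dimension `2` of `ℂ`. -/
theorem locallyIntegrable_pi_mul_inv :
    LocallyIntegrable (fun ζ : ℂ => ((Real.pi : ℂ) * ζ)⁻¹) := by
  refine locallyIntegrable_of_norm_le_rpow (C := Real.pi⁻¹) (α := 1) (by simp) (by simp) ?_ ?_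
  · refine Filter.Eventually.of_forall fun ζ => ?_
    rw [Real.rpow_neg_one, norm_inv, norm_mul, mul_inv, Complex.norm_real,
      Real.norm_of_nonneg Real.pi_pos.le]
  · exact (measurable_id.const_mul _).inv.aestronglyMeasurable

/-- The Cauchy transform in the variable `z_k`, which solves `∂u/∂z̄_k = g`. -/
noncomputable def cauchyTransform (k : Fin n) (g : (Fin n → ℂ) → F) (z : Fin n → ℂ) : F :=
  ∫ ζ : ℂ, ((Real.pi : ℂ) * ζ)⁻¹ • g (z - ζ • Pi.single k (1 : ℂ))

theorem norm_smul_single (k : Fin n) (ζ : ℂ) : ‖ζ • (Pi.single k (1 : ℂ) : Fin n → ℂ)‖ = ‖ζ‖ := by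
  rw [norm_smul, Pi.norm_single, norm_one, mul_one]

theorem integrable_cauchyTransform (k : Fin n) {g : (Fin n → ℂ) → F} (hg : Continuous g) {R : ℝ}
    (h0 : ∀ z, R ≤ ‖z‖ → g z = 0) (z : Fin n → ℂ) :
    Integrable fun ζ : ℂ => ((Real.pi : ℂ) * ζ)⁻¹ • g (z - ζ • Pi.single k (1 : ℂ)) := by
  refine locallyIntegrable_pi_mul_inv.integrable_smul_right_of_hasCompactSupport
    (hg.comp (by fun_prop)) ?_
  refine HasCompactSupport.intro (isCompact_closedBall (0 : ℂ) (R + ‖z‖)) fun ζ hζ => h0 _ ?_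
  have h1 := norm_sub_norm_le (ζ • (Pi.single k (1 : ℂ) : Fin n → ℂ)) z
  rw [norm_smul_single, norm_sub_rev] at h1
  rw [mem_closedBall_zero_iff] at hζ
  linarith

/-- Allows the transform of a form to be tested by evaluating it on vectors. -/
theorem cauchyTransform_map [CompleteSpace F] {G : Type*} [NormedAddCommGroup G] [NormedSpace ℂ G] [CompleteSpace G]
    {A : F →L[ℝ] G} (hA : ∀ (c : ℂ) x, A (c • x) = c • A x) (k : Fin n) {g : (Fin n → ℂ) → F}
    (hg : Continuous g) {R : ℝ} (h0 : ∀ z, R ≤ ‖z‖ → g z = 0) (z : Fin n → ℂ) :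
    A (cauchyTransform k g z) = cauchyTransform k (fun y => A (g y)) z := by
  rw [cauchyTransform, ← A.integral_comp_comm (integrable_cauchyTransform k hg h0 z)]
  simp only [hA]
  rfl

/-- Here `z` is a parameter and the convolution is taken at `0`, so regularity in `z` follows from
that of convolutions with parameters. -/
theorem cauchyTransform_eq_convolution (k : Fin n) (g : (Fin n → ℂ) → F) (z : Fin n → ℂ) :
    cauchyTransform k g z = convolution (fun ζ : ℂ => ((Real.pi : ℂ) * ζ)⁻¹)
      (fun ζ : ℂ => g (z + ζ • Pi.single k (1 : ℂ)))
      (ContinuousLinearMap.lsmul ℝ ℂ : ℂ →L[ℝ] F →L[ℝ] F) volume 0 := by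
  simp only [convolution_def, cauchyTransform, ContinuousLinearMap.lsmul_apply, zero_sub, neg_smul,
    ← sub_eq_add_neg]

/-- Gives the slices a common compact support while the parameter stays bounded. -/
theorem translate_eq_zero {F : Type*} [NormedAddCommGroup F] (k : Fin n) {g : (Fin n → ℂ) → F} {R : ℝ}
    (h0 : ∀ z, R ≤ ‖z‖ → g z = 0) (M : ℝ) (z : Fin n → ℂ) (ζ : ℂ) (hz : z ∈ Metric.ball 0 M)
    (hζ : ζ ∉ Metric.closedBall (0 : ℂ) (R + M)) : g (z + ζ • Pi.single k (1 : ℂ)) = 0 := by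
  refine h0 _ ?_
  have h1 := norm_sub_norm_le (ζ • (Pi.single k (1 : ℂ) : Fin n → ℂ)) (-z)
  rw [norm_smul_single, norm_neg, sub_neg_eq_add, add_comm _ z] at h1
  rw [mem_closedBall_zero_iff] at hζ
  rw [mem_ball_zero_iff] at hz
  linarith

theorem contDiff_cauchyTransform [CompleteSpace F] (k : Fin n) {g : (Fin n → ℂ) → F} (hg : ContDiff ℝ ∞ g) {R : ℝ}
    (h0 : ∀ z, R ≤ ‖z‖ → g z = 0) : ContDiff ℝ ∞ (cauchyTransform k g) := by
  rw [contDiff_iff_contDiffAt]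
  intro z
  have h1 := contDiffOn_convolution_right_with_param
    (ContinuousLinearMap.lsmul ℝ ℂ : ℂ →L[ℝ] F →L[ℝ] F) (n := ⊤)
    (g := fun (z : Fin n → ℂ) (ζ : ℂ) => g (z + ζ • Pi.single k (1 : ℂ)))
    (s := Metric.ball 0 (‖z‖ + 1)) Metric.isOpen_ball
    (isCompact_closedBall (0 : ℂ) (R + (‖z‖ + 1)))
    (fun z ζ => translate_eq_zero k h0 _ z ζ) locallyIntegrable_pi_mul_inv (μ := volume)
    (by
      refine ContDiff.contDiffOn ?_
      exact hg.comp (contDiff_fst.add (contDiff_snd.smul contDiff_const)))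
  have h2 : ContDiffOn ℝ ∞ (cauchyTransform k g) (Metric.ball 0 (‖z‖ + 1)) := by
    refine (h1.comp (f := fun z => (z, (0 : ℂ))) (contDiff_id.prodMk contDiff_const).contDiffOn
      (fun y hy => ⟨hy, trivial⟩)).congr fun y _ => ?_
    exact cauchyTransform_eq_convolution k g y
  exact h2.contDiffAt (Metric.isOpen_ball.mem_nhds (by simp))

theorem fderiv_cauchyTransform [CompleteSpace F] (k : Fin n) {g : (Fin n → ℂ) → F} (hg : ContDiff ℝ ∞ g) {R : ℝ}
    (h0 : ∀ z, R ≤ ‖z‖ → g z = 0) (z w : Fin n → ℂ) :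
    fderiv ℝ (cauchyTransform k g) z w = cauchyTransform k (fun y => fderiv ℝ g y w) z := by
  have hz : z ∈ Metric.ball (0 : Fin n → ℂ) (‖z‖ + 1) := by simp
  let G : (Fin n → ℂ) → ℂ → F := fun (z : Fin n → ℂ) (ζ : ℂ) => g (z + ζ • Pi.single k (1 : ℂ))
  have hG : ContDiff ℝ ∞ (Function.uncurry G) :=
    hg.comp (contDiff_fst.add (contDiff_snd.smul contDiff_const))
  have h1 := hasFDerivAt_convolution_right_with_param
    (ContinuousLinearMap.lsmul ℝ ℂ : ℂ →L[ℝ] F →L[ℝ] F) (g := G)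
    (s := Metric.ball 0 (‖z‖ + 1)) Metric.isOpen_ball
    (isCompact_closedBall (0 : ℂ) (R + (‖z‖ + 1)))
    (fun z ζ => translate_eq_zero k h0 _ z ζ) locallyIntegrable_pi_mul_inv (μ := volume)
    (hG.of_le (by simp)).contDiffOn (z, 0) hz
  have h2 : HasFDerivAt (fun y : Fin n → ℂ => (y, (0 : ℂ)))
    (ContinuousLinearMap.inl ℝ (Fin n → ℂ) ℂ) z := hasFDerivAt_prodMk_left z 0
  have h3 := h1.comp z h2
  have h4 : cauchyTransform k g = (fun q : (Fin n → ℂ) × ℂ =>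
      convolution (fun ζ : ℂ => ((Real.pi : ℂ) * ζ)⁻¹) (G q.1)
        (ContinuousLinearMap.lsmul ℝ ℂ : ℂ →L[ℝ] F →L[ℝ] F) volume q.2) ∘ fun y => (y, (0 : ℂ)) :=
    funext fun y => cauchyTransform_eq_convolution k g y
  -- The direction `(w, 0)` moves only the parameter, so this is the derivative of `g` itself.
  have hGd : ∀ ζ : ℂ, fderiv ℝ (Function.uncurry G) (z, ζ) (w, 0) =
      fderiv ℝ g (z + ζ • Pi.single k (1 : ℂ)) w := by
    intro ζ
    have h5 : HasFDerivAt (fun q : (Fin n → ℂ) × ℂ => q.1 + q.2 • (Pi.single k (1 : ℂ) : Fin n → ℂ))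
        (ContinuousLinearMap.fst ℝ (Fin n → ℂ) ℂ +
          (ContinuousLinearMap.snd ℝ (Fin n → ℂ) ℂ).smulRight (Pi.single k (1 : ℂ))) (z, ζ) :=
      hasFDerivAt_fst.add (hasFDerivAt_snd.smul_const _)
    have h6 := ((hg.differentiable (by simp)) (z + ζ • Pi.single k (1 : ℂ))).hasFDerivAt.comp
      (z, ζ) h5
    rw [show Function.uncurry G = g ∘ fun q : (Fin n → ℂ) × ℂ =>
      q.1 + q.2 • (Pi.single k (1 : ℂ) : Fin n → ℂ) from rfl, h6.fderiv]
    simp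
  rw [h4, h3.fderiv, ContinuousLinearMap.comp_apply, ContinuousLinearMap.inl_apply,
    convolution_precompR_apply _ locallyIntegrable_pi_mul_inv]
  · rw [cauchyTransform_eq_convolution]
    congr 1
    exact funext hGd
  · refine HasCompactSupport.intro (isCompact_closedBall (0 : ℂ) (R + (‖z‖ + 1))) fun ζ hζ => ?_
    have : Function.uncurry G =ᶠ[nhds (z, ζ)] fun _ => 0 := by
      filter_upwards [prod_mem_nhds (Metric.isOpen_ball.mem_nhds hz)
        (Metric.isClosed_closedBall.isOpen_compl.mem_nhds hζ)] with q hq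
      exact translate_eq_zero k h0 _ _ _ hq.1 hq.2
    exact this.fderiv_eq.trans (by simp)
  · exact (hG.continuous_fderiv (by simp)).comp (by fun_prop)

/-- The margin `1` leaves a whole neighbourhood on which `g` is zero. -/
theorem fderiv_eq_zero_of_le_norm {g : (Fin n → ℂ) → F} {R : ℝ}
    (h0 : ∀ z, R ≤ ‖z‖ → g z = 0) (z : Fin n → ℂ) (hz : R + 1 ≤ ‖z‖) : fderiv ℝ g z = 0 := by
  have : g =ᶠ[nhds z] fun _ => 0 := by
    filter_upwards [continuous_norm.continuousAt.eventually
      (lt_mem_nhds (by linarith : R < ‖z‖))] with y hy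
    exact h0 y hy.le
  rw [this.fderiv_eq]
  simp

theorem antilinearPart_fderiv_cauchyTransform [CompleteSpace F] (k : Fin n) {g : (Fin n → ℂ) → F}
    (hg : ContDiff ℝ ∞ g) {R : ℝ} (h0 : ∀ z, R ≤ ‖z‖ → g z = 0) (z w : Fin n → ℂ) :
    antilinearPart (fderiv ℝ (cauchyTransform k g) z) w =
      cauchyTransform k (fun y => antilinearPart (fderiv ℝ g y) w) z := by
  have hi : ∀ w, Integrable fun ζ : ℂ => ((Real.pi : ℂ) * ζ)⁻¹ •
      fderiv ℝ g (z - ζ • Pi.single k (1 : ℂ)) w := fun w =>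
    integrable_cauchyTransform k ((hg.continuous_fderiv (by simp)).clm_apply continuous_const)
      (R := R + 1) (fun y hy => by rw [fderiv_eq_zero_of_le_norm h0 y hy]; rfl) z
  rw [antilinearPart_apply, fderiv_cauchyTransform k hg h0, fderiv_cauchyTransform k hg h0]
  simp only [cauchyTransform, antilinearPart_apply]
  rw [← integral_smul, ← integral_add (hi w) ((hi (Complex.I • w)).fun_smul Complex.I),
    ← integral_smul]
  refine integral_congr_ae (Filter.Eventually.of_forall fun ζ => ?_)
  module

/-- Cauchy–Pompeiu on the complex line through `z` in direction `e_k`. Since the transform commutes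
with `∂/∂z̄_k`, this says that it solves `∂u/∂z̄_k = g`. -/
theorem cauchyTransform_antilinearPart_fderiv [CompleteSpace F] (k : Fin n) {g : (Fin n → ℂ) → F}
    (hg : ContDiff ℝ ∞ g) {R : ℝ} (h0 : ∀ z, R ≤ ‖z‖ → g z = 0) (z : Fin n → ℂ) :
    cauchyTransform k (fun y => antilinearPart (fderiv ℝ g y) (Pi.single k (1 : ℂ))) z = g z := by
  let h : ℂ → F := fun ζ => g (z + ζ • Pi.single k (1 : ℂ))
  have hh : ContDiff ℝ 1 h :=
    (hg.of_le (by simp)).comp (contDiff_const.add (contDiff_id.smul contDiff_const))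
  have hd : ∀ ζ w, fderiv ℝ h ζ w =
      fderiv ℝ g (z + ζ • Pi.single k (1 : ℂ)) (w • Pi.single k (1 : ℂ)) := by
    intro ζ w
    have h5 : HasFDerivAt (fun ζ : ℂ => z + ζ • (Pi.single k (1 : ℂ) : Fin n → ℂ))
        ((ContinuousLinearMap.id ℝ ℂ).smulRight (Pi.single k (1 : ℂ))) ζ :=
      ((hasFDerivAt_id ζ).smul_const _).const_add z
    have h6 := ((hg.differentiable (by simp)) (z + ζ • Pi.single k (1 : ℂ))).hasFDerivAt.comp ζ h5
    rw [show h = g ∘ fun ζ : ℂ => z + ζ • (Pi.single k (1 : ℂ) : Fin n → ℂ) from rfl, h6.fderiv]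
    rfl
  -- `R` may be negative, so positivity of the radius is imposed by the maximum with `1`.
  obtain ⟨S, hS, hRS⟩ : ∃ S : ℝ, 0 < S ∧ R + ‖z‖ < S :=
    ⟨max 1 (R + ‖z‖ + 1), by positivity, lt_of_lt_of_le (by linarith) (le_max_right _ _)⟩
  have hS0 : ∀ ζ, S ≤ ‖ζ‖ → h ζ = 0 := by
    intro ζ hζ
    refine h0 _ ?_
    have h1 := norm_sub_norm_le (ζ • (Pi.single k (1 : ℂ) : Fin n → ℂ)) (-z)
    rw [norm_smul_single, norm_neg, sub_neg_eq_add, add_comm _ z] at h1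
    linarith
  have h1 := integral_inv_smul_antilinearPart hh hS hS0
  have h2 : ∀ ζ, antilinearPart (fderiv ℝ h ζ) (1 : ℂ) = antilinearPart
      (fderiv ℝ g (z + ζ • Pi.single k (1 : ℂ))) (Pi.single k (1 : ℂ)) := by
    intro ζ
    simp only [antilinearPart_apply, hd, one_smul, smul_assoc]
  simp only [h2] at h1
  have hpi : (Real.pi : ℂ) ≠ 0 := by exact_mod_cast Real.pi_pos.ne'
  -- Replacing `ζ` by `-ζ` turns the kernel into `-1 / (πζ)`, whose sign cancels that of `-π`.
  rw [cauchyTransform, ← integral_neg_eq_self]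
  calc _ = ∫ ζ : ℂ, (-(Real.pi : ℂ)⁻¹) • (ζ⁻¹ • antilinearPart
      (fderiv ℝ g (z + ζ • Pi.single k (1 : ℂ))) (Pi.single k (1 : ℂ))) := by
        refine integral_congr_ae (Filter.Eventually.of_forall fun ζ => ?_)
        simp only [neg_smul, sub_neg_eq_add, smul_smul, mul_neg, inv_neg, mul_inv, neg_mul]
    _ = g z := by
      rw [integral_smul, h1, smul_smul, neg_mul_neg, inv_mul_cancel₀ hpi, one_smul]
      simp [h]

end CauchyTransform

/-! ### Solving `∂̄μ = η` on small polydiscs. -/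

section LocalSolution

variable {n p : ℕ} {E : Type*} [NormedAddCommGroup E] [NormedSpace ℂ E]

/-- A smooth cutoff function on a polydisc, of product form. -/
theorem exists_product_cutoff (x₀ : Fin n → ℂ) {ρ : ℝ} (hρ : 0 < ρ) (k : Fin n) :
    ∃ χ : (Fin n → ℂ) → ℂ, ContDiff ℝ ∞ χ ∧
      (∀ y, y ∉ Metric.closedBall x₀ (3 / 4 * ρ) → χ y = 0) ∧
      ∀ z ∈ Metric.ball x₀ (ρ / 2), χ z = 1 ∧
        ∀ (ζ : ℂ) (w : Fin n → ℂ), w k = 0 →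
          fderiv ℝ χ (z - ζ • Pi.single k (1 : ℂ)) w = 0 := by
  -- One bump per coordinate, equal to `1` up to `ρ / 2` and supported within `3ρ / 4 < ρ`. Balls
  -- are polydiscs for the sup norm.
  let β : ∀ i, ContDiffBump (x₀ i) := fun i => ⟨ρ / 2, 3 / 4 * ρ, by positivity, by linarith⟩
  have hβ : ∀ i, ContDiff ℝ ∞ fun y : ℂ => ((β i y : ℝ) : ℂ) := fun i =>
    Complex.ofRealCLM.contDiff.comp (β i).contDiff
  have h1 : ∀ i (y : ℂ), dist y (x₀ i) < ρ / 2 → ((β i y : ℝ) : ℂ) = 1 := by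
    intro i y hy
    rw [(β i).one_of_mem_closedBall (Metric.mem_closedBall.2 hy.le), Complex.ofReal_one]
  refine ⟨fun z => ∏ i, ((β i (z i) : ℝ) : ℂ), ?_, ?_, ?_⟩
  · exact contDiff_prod fun i _ => (hβ i).comp (contDiff_apply ℝ ℂ i)
  · intro y hy
    rw [Metric.mem_closedBall, dist_pi_le_iff (by positivity)] at hy
    push Not at hy
    obtain ⟨i, hi⟩ := hy
    refine Finset.prod_eq_zero (Finset.mem_univ i) ?_
    rw [(β i).zero_of_le_dist hi.le, Complex.ofReal_zero]
  · intro z hz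
    rw [Metric.mem_ball, dist_pi_lt_iff (by positivity)] at hz
    refine ⟨Finset.prod_eq_one fun i _ => h1 i _ (hz i), fun ζ w hw => ?_⟩
    set y := z - ζ • (Pi.single k (1 : ℂ) : Fin n → ℂ) with hy
    have h2 : (fun u : Fin n → ℂ => ∏ i, ((β i (u i) : ℝ) : ℂ)) =ᶠ[nhds y]
        fun u => ((β k (u k) : ℝ) : ℂ) := by
      -- Moving along `e_k` leaves the other coordinates within `ρ / 2`, so near `y` every factor
      -- but the `k`-th is `1`, however large `ζ` is.
      have h3 : ∀ᶠ u : Fin n → ℂ in nhds y, ∀ i, i ≠ k → dist (u i) (x₀ i) < ρ / 2 := by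
        rw [Filter.eventually_all]
        intro i
        by_cases hi : i = k
        · simp [hi]
        · have h4 : Filter.Tendsto (fun u : Fin n → ℂ => dist (u i) (x₀ i)) (nhds y)
              (nhds (dist (y i) (x₀ i))) :=
            ((continuous_apply i).dist continuous_const).tendsto y
          have h5 : dist (y i) (x₀ i) < ρ / 2 := by
            simpa [hy, hi] using hz i
          exact (h4.eventually (gt_mem_nhds h5)).mono fun u hu _ => hu
      filter_upwards [h3] with u hu
      exact Finset.prod_eq_single k (fun i _ hi => h1 i _ (hu i hi)) (by simp)
    have h6 : HasFDerivAt (fun u : Fin n → ℂ => ((β k (u k) : ℝ) : ℂ))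
        ((fderiv ℝ (fun y : ℂ => ((β k y : ℝ) : ℂ)) (y k)).comp
          (ContinuousLinearMap.proj (R := ℝ) (φ := fun _ : Fin n => ℂ) k)) y :=
      (((hβ k).differentiable (by simp)) (y k)).hasFDerivAt.comp y
        (hasFDerivAt_apply (𝕜 := ℝ) (F' := fun _ : Fin n => ℂ) k y)
    rw [h2.fderiv_eq, h6.fderiv, ContinuousLinearMap.comp_apply, ContinuousLinearMap.proj_apply, hw,
      map_zero]

/-- Extension by zero: as `a < ρ`, the open ball and the complement of the closed ball of radius `a`
cover the space. -/
theorem contDiff_cutoff_smul {F : Type*} [NormedAddCommGroup F] [NormedSpace ℂ F]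
    {x₀ : Fin n → ℂ} {a ρ : ℝ} (haρ : a < ρ) {χ : (Fin n → ℂ) → ℂ} (hχ : ContDiff ℝ ∞ χ)
    (h0 : ∀ y, y ∉ Metric.closedBall x₀ a → χ y = 0) {f : (Fin n → ℂ) → F}
    (hf : ContDiffOn ℝ ∞ f (Metric.ball x₀ ρ)) : ContDiff ℝ ∞ fun y => χ y • f y := by
  rw [contDiff_iff_contDiffAt]
  intro y
  by_cases hy : y ∈ Metric.ball x₀ ρ
  · exact hχ.contDiffAt.smul (hf.contDiffAt (Metric.isOpen_ball.mem_nhds hy))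
  · have hy' : y ∈ (Metric.closedBall x₀ a)ᶜ := fun h =>
      hy (Metric.closedBall_subset_ball haρ h)
    have : (fun y => χ y • f y) =ᶠ[nhds y] fun _ => 0 := by
      filter_upwards [Metric.isClosed_closedBall.isOpen_compl.mem_nhds hy'] with u hu
      rw [h0 u hu, zero_smul]
    exact contDiffAt_const.congr_of_eventuallyEq this

theorem cutoff_eq_zero_of_le_norm {x₀ : Fin n → ℂ} {a : ℝ} {χ : (Fin n → ℂ) → ℂ}
    (h0 : ∀ y, y ∉ Metric.closedBall x₀ a → χ y = 0) (y : Fin n → ℂ) (hy : ‖x₀‖ + a + 1 ≤ ‖y‖) :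
    χ y = 0 := by
  refine h0 y fun h => ?_
  rw [mem_closedBall_iff_norm] at h
  have := norm_sub_norm_le y x₀
  linarith

theorem cauchyTransform_sum {F ι : Type*} [NormedAddCommGroup F] [NormedSpace ℂ F] (s : Finset ι)
    (k : Fin n) (c : ι → ℂ) {g : ι → (Fin n → ℂ) → F} (hg : ∀ i, Continuous (g i)) {R : ℝ}
    (h0 : ∀ i z, R ≤ ‖z‖ → g i z = 0) (z : Fin n → ℂ) :
    cauchyTransform k (fun y => ∑ i ∈ s, c i • g i y) z = ∑ i ∈ s, c i • cauchyTransform k (g i) z := by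
  simp only [cauchyTransform, Finset.smul_sum, ← MeasureTheory.integral_smul]
  rw [← MeasureTheory.integral_finsetSum]
  · refine MeasureTheory.integral_congr_ae (Filter.Eventually.of_forall fun ζ => ?_)
    exact Finset.sum_congr rfl fun i _ => smul_comm _ _ _
  · exact fun i _ => (integrable_cauchyTransform k (hg i) (h0 i) z).smul (c i)

theorem isAnn_cauchyTransform [CompleteSpace E] (k : Fin n) {j : Fin n}
    {g : (Fin n → ℂ) → (Fin n → ℂ) [⋀^Fin p]→L[ℝ] E} (hg : Continuous g) {R : ℝ}
    (h0 : ∀ z, R ≤ ‖z‖ → g z = 0) (h : ∀ z, IsAnn j (g z)) (z : Fin n → ℂ) :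
    IsAnn j (cauchyTransform k g z) := by
  intro v i hi
  let A : ((Fin n → ℂ) [⋀^Fin p]→L[ℝ] E) →L[ℝ] E :=
    evalForm (Function.update v i (Pi.single j (1 : ℂ))) +
      Complex.I • evalForm (Function.update v i (Complex.I • Pi.single j (1 : ℂ)))
  have hA : ∀ (c : ℂ) α, A (c • α) = c • A α := by
    intro c α
    simp only [A, add_apply, smul_apply, evalForm_apply, ContinuousAlternatingMap.smul_apply]
    module
  have h1 : ∀ y, A (g y) = 0 := fun y => h y v i hi
  have h2 := cauchyTransform_map hA k hg h0 z
  simp only [h1] at h2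
  refine h2.trans ?_
  simp [cauchyTransform]

/-- Monomials have constant coefficients, so the transform acts on the coefficient functions alone.
-/
theorem isPureForm_cauchyTransform [CompleteSpace E] {r s : ℕ} {x₀ : Fin n → ℂ} {a ρ : ℝ}
    (haρ : a < ρ) {χ : (Fin n → ℂ) → ℂ} (hχ : ContDiff ℝ ∞ χ)
    (h0 : ∀ y, y ∉ Metric.closedBall x₀ a → χ y = 0)
    {η : (Fin n → ℂ) → (Fin n → ℂ) [⋀^Fin (p + 1)]→L[ℝ] E}
    (hη : IsPureForm r s (Metric.ball x₀ ρ) η) (k : Fin n) (U : Set (Fin n → ℂ)) :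
    IsPureForm r (s - 1) U (cauchyTransform k fun y => χ y • contr k (η y)) := by
  have hcont : ContDiff ℝ ∞ fun y => χ y • contr k (η y) := contDiff_cutoff_smul haρ hχ h0
    ((contr (p := p) (E := E) k).contDiff.comp_contDiffOn hη.contDiffOn)
  obtain ⟨f, hf, hη⟩ := hη
  have hχ0 := cutoff_eq_zero_of_le_norm h0
  have hs : ∀ K, ContDiff ℝ ∞ fun y => χ y • f K y := fun K =>
    contDiff_cutoff_smul haρ hχ h0 (hf K)
  have hs0 : ∀ K y, ‖x₀‖ + a + 1 ≤ ‖y‖ → χ y • f K y = 0 := fun K y hy => by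
    rw [hχ0 y hy, zero_smul]
  refine isPureForm_of_contr (r := r) (s := s) k
    (fun K => cauchyTransform k fun y => χ y • f K y)
    (fun K => (contDiff_cauchyTransform k (hs K) (hs0 K)).contDiffOn) fun z _ v => ?_
  have h1 := cauchyTransform_map (A := evalForm (E := E) v) (fun c α => rfl) k hcont.continuous
    (R := ‖x₀‖ + a + 1) (fun y hy => by rw [hχ0 y hy, zero_smul]) z
  rw [evalForm_apply] at h1
  rw [h1, ← cauchyTransform_sum _ k _ (fun K => (hs K).continuous) hs0]
  congr 1
  ext y
  rw [evalForm_apply, ContinuousAlternatingMap.smul_apply]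
  by_cases hy : y ∈ Metric.ball x₀ ρ
  · rw [contr_apply_of_eq_sum _ (fun K => K) (fun K => f K y) (hη y hy), Finset.smul_sum]
    exact Finset.sum_congr rfl fun K _ => smul_comm _ _ _
  -- Outside the ball the expansion of `η` is unavailable, but the cutoff makes both sides zero.
  · rw [h0 y fun h => hy (Metric.closedBall_subset_ball haρ h)]
    simp

/-- One integration step: a `∂̄`-closed form annihilated by `∂/∂z̄_j`, `j ∈ S`, is modulo `∂̄`-exact
forms annihilated also by `∂/∂z̄_k`. -/
theorem exists_delbar_isAnn_insert [CompleteSpace E] {r s : ℕ} {x₀ : Fin n → ℂ} {ρ : ℝ}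
    (hρ : 0 < ρ) {η : (Fin n → ℂ) → (Fin n → ℂ) [⋀^Fin (p + 1)]→L[ℝ] E}
    (hη : IsPureForm r s (Metric.ball x₀ ρ) η) (hcl : ∀ x ∈ Metric.ball x₀ ρ, delbar η x = 0)
    (S : Finset (Fin n)) (hS : ∀ j ∈ S, ∀ x ∈ Metric.ball x₀ ρ, IsAnn j (η x)) (k : Fin n) :
    ∃ ν : (Fin n → ℂ) → (Fin n → ℂ) [⋀^Fin p]→L[ℝ] E,
      IsPureForm r (s - 1) (Metric.ball x₀ (ρ / 2)) ν ∧
      ∀ j ∈ insert k S, ∀ x ∈ Metric.ball x₀ (ρ / 2), IsAnn j (η x - delbar ν x) := by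
  obtain ⟨χ, hχ, h0, h1⟩ := exists_product_cutoff x₀ hρ k
  have haρ : 3 / 4 * ρ < ρ := by linarith
  have hηs := hη.contDiffOn
  have hηd : ∀ y ∈ Metric.ball x₀ ρ, DifferentiableAt ℝ η y := fun y hy =>
    (hηs.contDiffAt (Metric.isOpen_ball.mem_nhds hy)).differentiableAt (by simp)
  set g : (Fin n → ℂ) → (Fin n → ℂ) [⋀^Fin p]→L[ℝ] E := fun y => χ y • contr k (η y) with hg_def
  have hg : ContDiff ℝ ∞ g := contDiff_cutoff_smul haρ hχ h0
    ((contr (p := p) (E := E) k).contDiff.comp_contDiffOn hηs)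
  have hg0 : ∀ y, ‖x₀‖ + 3 / 4 * ρ + 1 ≤ ‖y‖ → g y = 0 := fun y hy => by
    rw [hg_def]
    simp only [cutoff_eq_zero_of_le_norm h0 y hy, zero_smul]
  have hann : ∀ j ∈ insert k S, ∀ y, IsAnn j (g y) := by
    intro j hj y
    by_cases hy : y ∈ Metric.ball x₀ ρ
    · refine IsAnn.smul ?_ _
      rcases Finset.mem_insert.1 hj with rfl | hj
      · exact isAnn_contr_self _ _
      · exact (hS j hj y hy).contr k
    · have : g y = (0 : ℂ) • contr k (η y) := by
        rw [hg_def]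
        simp only [h0 y fun h => hy (Metric.closedBall_subset_ball haρ h)]
      rw [this]
      intro v i _
      simp
  -- All `ζ` are needed because the transform integrates over the whole line, including points
  -- outside the ball, where `g` is locally zero.
  have hdg : ∀ j ∈ S, j ≠ k → ∀ z ∈ Metric.ball x₀ (ρ / 2), ∀ ζ : ℂ,
      antilinearPart (fderiv ℝ g (z - ζ • Pi.single k (1 : ℂ))) (Pi.single j (1 : ℂ)) = 0 := by
    intro j hj hjk z hz ζ
    have hχd := (h1 z hz).2 ζ
    set y := z - ζ • (Pi.single k (1 : ℂ) : Fin n → ℂ)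
    by_cases hy : y ∈ Metric.ball x₀ ρ
    · have h2 : HasFDerivAt (fun u => contr k (η u)) ((contr k).comp (fderiv ℝ η y)) y :=
        (contr (p := p) (E := E) k).hasFDerivAt.comp y (hηd y hy).hasFDerivAt
      have h3 := ((hχ.differentiable (by simp)) y).hasFDerivAt.smul h2
      have h4 : ∀ w : Fin n → ℂ, w k = 0 → fderiv ℝ g y w = χ y • contr k (fderiv ℝ η y w) := by
        intro w hw
        have h5 := congrArg (fun L => L w) h3.fderiv
        refine h5.trans ?_
        simp [hχd w hw]
      -- Cartan's formula for `η`, already annihilated by `∂/∂z̄_j`, converts closedness into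
      -- `∂η/∂z̄_j = 0`.
      have h7 : antilinearPart (fderiv ℝ η y) (Pi.single j (1 : ℂ)) = 0 := by
        rw [← contr_delbar (hηd y hy) ((Metric.isOpen_ball.eventually_mem hy).mono (hS j hj)),
          hcl y hy, map_zero]
      have hw1 : (Pi.single j (1 : ℂ) : Fin n → ℂ) k = 0 := by simp [hjk.symm]
      have hw2 : (Complex.I • Pi.single j (1 : ℂ) : Fin n → ℂ) k = 0 := by simp [hjk.symm]
      have h8 := (smul_eq_zero.1 ((antilinearPart_apply _ _).symm.trans h7)).resolve_left
        (by norm_num)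
      have h9 := congrArg (contr k) h8
      rw [map_add, contr_smul, map_zero] at h9
      rw [antilinearPart_apply, h4 _ hw1, h4 _ hw2, smul_comm Complex.I, ← smul_add (χ y), h9,
        smul_zero, smul_zero]
    · have h2 : g =ᶠ[nhds y] fun _ => 0 := by
        have hy' : y ∈ (Metric.closedBall x₀ (3 / 4 * ρ))ᶜ := fun h =>
          hy (Metric.closedBall_subset_ball haρ h)
        filter_upwards [Metric.isClosed_closedBall.isOpen_compl.mem_nhds hy'] with u hu
        rw [hg_def]
        simp only [h0 u hu, zero_smul]
      rw [h2.fderiv_eq, antilinearPart_apply]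
      simp
  have hνd : ContDiff ℝ ∞ (cauchyTransform k g) := contDiff_cauchyTransform k hg hg0
  refine ⟨cauchyTransform k g, isPureForm_cauchyTransform haρ hχ h0 hη k _, fun j hj z hz => ?_⟩
  have hz' : z ∈ Metric.ball x₀ ρ := Metric.ball_subset_ball (by linarith) hz
  rw [isAnn_iff_contr_eq_zero, map_sub, contr_delbar (hνd.differentiable (by simp) z)
    (Filter.Eventually.of_forall
      (isAnn_cauchyTransform k hg.continuous hg0 (hann j hj))),
    antilinearPart_fderiv_cauchyTransform k hg hg0]
  -- For `j = k` the transform inverts `∂/∂z̄_k` and `χ z = 1`; for `j ≠ k` both terms vanish.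
  by_cases hjk : j = k
  · subst hjk
    rw [cauchyTransform_antilinearPart_fderiv _ hg hg0, hg_def]
    simp only [(h1 z hz).1, one_smul, sub_self]
  · have hjS : j ∈ S := (Finset.mem_insert.1 hj).resolve_left hjk
    rw [(hS j hjS z hz').contr_eq_zero]
    simp only [cauchyTransform, hdg j hjS hjk z hz, smul_zero, MeasureTheory.integral_zero, sub_self]

/-- Induction on `S`: subtracting `∂̄μ` preserves closedness because `∂̄∂̄ = 0`, so the integration
step can be repeated, each time halving the radius. -/
theorem exists_delbar_isAnn [CompleteSpace E] {r s : ℕ} {x₀ : Fin n → ℂ} {ρ₀ : ℝ}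
    (hρ₀ : 0 < ρ₀) {η : (Fin n → ℂ) → (Fin n → ℂ) [⋀^Fin (p + 1)]→L[ℝ] E} (hs : 1 ≤ s)
    (hη : IsPureForm r s (Metric.ball x₀ ρ₀) η) (hcl : ∀ x ∈ Metric.ball x₀ ρ₀, delbar η x = 0)
    (S : Finset (Fin n)) :
    ∃ ρ, 0 < ρ ∧ ρ ≤ ρ₀ ∧ ∃ μ : (Fin n → ℂ) → (Fin n → ℂ) [⋀^Fin p]→L[ℝ] E,
      IsPureForm r (s - 1) (Metric.ball x₀ ρ) μ ∧
      ∀ j ∈ S, ∀ x ∈ Metric.ball x₀ ρ, IsAnn j (η x - delbar μ x) := by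
  induction S using Finset.induction_on with
  | empty => exact ⟨ρ₀, hρ₀, le_rfl, fun _ => 0, IsPureForm.zero, by simp⟩
  | insert k S _ ih =>
    obtain ⟨ρ, hρ, hρρ₀, μ, hμ, hann⟩ := ih
    have hball := Metric.ball_subset_ball (x := x₀) hρρ₀
    have hdμ : IsPureForm r s (Metric.ball x₀ ρ) (delbar μ) := by
      have := hμ.delbar Metric.isOpen_ball
      rwa [Nat.sub_add_cancel hs] at this
    have hd : ∀ {q : ℕ} {a b : ℕ} {σ : ℝ} {θ : (Fin n → ℂ) → (Fin n → ℂ) [⋀^Fin q]→L[ℝ] E},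
        IsPureForm a b (Metric.ball x₀ σ) θ → ∀ x ∈ Metric.ball x₀ σ, ContDiffAt ℝ ∞ θ x :=
      fun h x hx => h.contDiffOn.contDiffAt (Metric.isOpen_ball.mem_nhds hx)
    have hcl' : ∀ x ∈ Metric.ball x₀ ρ, delbar (fun y => η y - delbar μ y) x = 0 := by
      intro x hx
      rw [delbar_sub ((hd hη x (hball hx)).differentiableAt (by simp))
        ((hd hdμ x hx).differentiableAt (by simp)), hcl x (hball hx),
        delbar_eq_zero_of_delbar (hd hμ x hx), sub_zero]
    obtain ⟨ν, hν, hνann⟩ := exists_delbar_isAnn_insert hρ ((hη.mono hball).sub hdμ) hcl' S hann k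
    have hhalf := Metric.ball_subset_ball (x := x₀) (show ρ / 2 ≤ ρ by linarith)
    refine ⟨ρ / 2, by positivity, by linarith, fun x => μ x + ν x, (hμ.mono hhalf).add hν,
      fun j hj x hx => ?_⟩
    rw [delbar_add ((hd hμ x (hhalf hx)).differentiableAt (by simp))
      ((hd hν x hx).differentiableAt (by simp)), ← sub_sub]
    exact hνann j hj x hx

/-- The local form of the lemma, on a polydisc. -/
theorem exists_eq_delbar [CompleteSpace E] {r s : ℕ} {U : Set (Fin n → ℂ)} (hU : IsOpen U)
    {η : (Fin n → ℂ) → (Fin n → ℂ) [⋀^Fin (p + 1)]→L[ℝ] E} (hs : 1 ≤ s)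
    (hη : IsPureForm r s U η) (hcl : ∀ x ∈ U, delbar η x = 0) {x₀ : Fin n → ℂ} (hx₀ : x₀ ∈ U) :
    ∃ W ⊆ U, IsOpen W ∧ x₀ ∈ W ∧ ∃ μ : (Fin n → ℂ) → (Fin n → ℂ) [⋀^Fin p]→L[ℝ] E,
      IsPureForm r (s - 1) W μ ∧ ∀ x ∈ W, η x = delbar μ x := by
  obtain ⟨ρ₀, hρ₀, hsub⟩ := Metric.isOpen_iff.1 hU x₀ hx₀
  obtain ⟨ρ, hρ, hρρ₀, μ, hμ, hann⟩ := exists_delbar_isAnn hρ₀ hs (hη.mono hsub)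
    (fun x hx => hcl x (hsub hx)) Finset.univ
  have hWU : Metric.ball x₀ ρ ⊆ U := (Metric.ball_subset_ball hρρ₀).trans hsub
  refine ⟨Metric.ball x₀ ρ, hWU, Metric.isOpen_ball, Metric.mem_ball_self hρ, μ, hμ,
    fun x hx => ?_⟩
  have hdμ : IsPureForm r s (Metric.ball x₀ ρ) (delbar μ) := by
    have := hμ.delbar Metric.isOpen_ball
    rwa [Nat.sub_add_cancel hs] at this
  -- The difference `η - ∂̄μ` has type `(r, s)` and is annihilated by every `∂/∂z̄_j`, so Euler's
  -- formula applies at each point.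
  obtain ⟨f, _, hf⟩ := (hη.mono hWU).sub hdμ
  exact sub_eq_zero.1 (eq_zero_of_isAnn (Nat.one_le_iff_ne_zero.1 hs) (fun K => f K x) (hf x hx)
    fun j => hann j (Finset.mem_univ j) x hx)

end LocalSolution

/-! ### From local solutions to the equivalence. -/

theorem mainTheorem3 {n p r s : ℕ} {E : Type*} [NormedAddCommGroup E] [NormedSpace ℂ E]
    [CompleteSpace E] (hp : r + s = p + 1) (hs : 1 ≤ s)
    (U : Set (Fin n → ℂ)) (hU : IsOpen U)
    (η : (Fin n → ℂ) → (Fin n → ℂ) [⋀^Fin (p + 1)]→L[ℝ] E) (hη : IsPureForm r s U η) :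
    (∀ x ∈ U, delbar η x = 0) ↔
      ∃ (ι : Type) (W : ι → Set (Fin n → ℂ))
        (μ : ι → (Fin n → ℂ) → (Fin n → ℂ) [⋀^Fin p]→L[ℝ] E),
        (∀ a, IsOpen (W a)) ∧ (⋃ a, W a) = U ∧
        ∀ a, IsPureForm r (s - 1) (W a) (μ a) ∧ ∀ x ∈ W a, η x = delbar (μ a) x := by
  constructor
  · intro hcl
    -- The cover is indexed by the points of `U`.
    choose W hWU hW hxW μ hμ hημ using fun x : U => exists_eq_delbar hU hs hη hcl x.2
    refine ⟨U, W, μ, hW, ?_, fun a => ⟨hμ a, hημ a⟩⟩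
    refine Set.Subset.antisymm (Set.iUnion_subset hWU) fun x hx => ?_
    exact Set.mem_iUnion.2 ⟨⟨x, hx⟩, hxW ⟨x, hx⟩⟩
  · rintro ⟨ι, W, μ, hW, hWU, h⟩ x hx
    rw [← hWU] at hx
    obtain ⟨a, ha⟩ := Set.mem_iUnion.1 hx
    -- Equality on the open set `W a` is equality of germs, so `∂̄η = ∂̄∂̄(μ a) = 0` at `x`.
    have h1 : η =ᶠ[nhds x] delbar (μ a) :=
      ((hW a).eventually_mem ha).mono fun y hy => (h a).2 y hy
    rw [delbar_congr h1]
    exact delbar_eq_zero_of_delbar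
      ((h a).1.contDiffOn.contDiffAt ((hW a).mem_nhds ha))
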